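/- Let $p$ be an odd prime, let $q-1$ be a formal variable, $R=\mathbb Z_p[[q-1]]$, $Q=\operatorname{Frac}(R)$, and for $a\in\mathbb Z_p$ put $[a]_q=\sum_{i\ge 1}\binom{a}{i}(q-1)^{i-1}\in R$. Let $\varphi\colon R\to R$ be the continuous $\mathbb Z_p$-algebra endomorphism with $\varphi(q)=q^p$. On $R[[\lambda]]$ let $\gamma$ be the $R$-algebra endomorphism $\gamma\bigl(\sum_n c_n\lambda^n\bigr)=\sum_n c_nq^n\lambda^n$ and let $d_q=\frac{\gamma-1}{(q-1)\lambda}$. For $g\in R[\lambda]$ let $R\langle\lambda,\frac1g\rangle$ be the $(p,q-1)$-adic completion of $R[\lambda,\frac1g]$; if $g(0)=1$, the inclusion $R[\lambda]\subset R[[\lambda]]$ extends canonically to a continuous ring homomorphism $R\langle\lambda,\frac1g\rangle\to R[[\lambda]]$. (1) Let $B\colon\mathbb N=\{0,1,2,\dots\}\to R$ be a map with $B(n)\neq 0$ for all $n$ and $B(0)=1$ such that for all $n,m,s\in\mathbb N$ $$\frac{B(n+mp^{s+1})}{\varphi\bigl(B(\lfloor n/p\rfloor+mp^s)\bigr)}-\frac{B(n)}{\varphi\bigl(B(\lfloor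 n/p\rfloor)\bigr)}\in[p^{s+1}]_qR,\qquad \frac{B(n)}{\varphi\bigl(B(\lfloor n/p\rfloor)\bigr)}\in R$$ (the quotients are taken in $Q$). Put $F=\sum_{n\ge0}B(n)\lambda^n\in R[[\lambda]]$, $F_1=\sum_{n=0}^{p-1}B(n)\lambda^n$ and $T=R\langle\lambda,\frac1{F_1}\rangle$. Then the canonical homomorphism $T\to R[[\lambda]]$ is injective, and, regarding $T$ as a subring of $R[[\lambda]]$ through it, $$\frac{d_qF}{F}\in T\qquad\text{and}\qquad \frac{d_qF}{\gamma(F)}\in T.$$ (2) For $n\ge0$ the element $a_n=\prod_{i=0}^{n-1}\left(\frac{[i+\frac12]_q}{[i+1]_q}\right)^2$ of $Q$ lies in $R$. Let $F=\sum_{n\ge0}a_n\lambda^n$ be the $q$-hypergeometric series, $F_1=\sum_{n=0}^{p-1}a_n\lambda^n$, let $h=\sum_{i=0}^{(p-1)/2}\binom{(p-1)/2}{i}^2\lambda^i$ be the Hasse polynomial, and $S'=R\langle\lambda,\frac1h\rangle$. Then $T=R\langle\lambda,\frac1{F_1}\rangle$ equals $S'$: there is an isomorphism of $R[\lambda]$-algebras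 $T\cong S'$ compatible with the canonical homomorphisms to $R[[\lambda]]$. -/

import Mathlib

noncomputable section

namespace QDwork

open PowerSeries

/-! ## The base ring `R = ℤ_p[[q-1]]` -/

section Base

variable (p : ℕ) [Fact p.Prime]

/-- The ring `R = ℤ_p[[q-1]]`; the power series variable is `q - 1`. -/
abbrev BaseRing : Type := PowerSeries ℤ_[p]

/-- The element `q = 1 + (q-1)` of `R`. -/
def qElt : BaseRing p := 1 + PowerSeries.X

theorem qElt_sub_one : qElt p - 1 = PowerSeries.X := by
  simp [qElt]

theorem hasSubst_frob : PowerSeries.HasSubst ((qElt p) ^ p - 1 : BaseRing p) := by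
  apply PowerSeries.HasSubst.of_constantCoeff_zero'
  simp [qElt]

/-- The Frobenius endomorphism `φ` of `R`: it is the identity on `ℤ_p` and sends `q` to `q ^ p`,
that is, it substitutes `q ^ p - 1` for the variable `q - 1`. -/
def frob : BaseRing p →ₐ[ℤ_[p]] BaseRing p :=
  PowerSeries.substAlgHom (hasSubst_frob p)

theorem frob_qElt : frob p (qElt p) = qElt p ^ p := by
  have h : frob p (PowerSeries.X) = (qElt p) ^ p - 1 := PowerSeries.substAlgHom_X _
  rw [qElt, map_add, map_one, h, qElt]
  ring

variable {p}

/-- The `q`-number `[a]_q = (q ^ a - 1) / (q - 1) = ∑_{i ≥ 1} (a choose i) (q - 1) ^ (i - 1)`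
of a `p`-adic integer `a`. -/
def qNum (a : ℤ_[p]) : BaseRing p :=
  PowerSeries.mk fun i => Ring.choose a (i + 1)

/-- `(q - 1) [a]_q = q ^ a - 1`, where `q ^ a = (1 + (q - 1)) ^ a` is the binomial series. -/
theorem mul_qNum (a : ℤ_[p]) :
    (qElt p - 1) * qNum a = PowerSeries.binomialSeries ℤ_[p] a - 1 := by
  rw [qElt_sub_one]
  ext n
  cases n with
  | zero => simp
  | succ n =>
    rw [PowerSeries.coeff_succ_X_mul]
    simp [qNum, PowerSeries.coeff_one]

theorem qNum_natCast (n : ℕ) :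
    qNum (n : ℤ_[p]) = ∑ i ∈ Finset.range n, qElt p ^ i := by
  have hX : (qElt p - 1 : BaseRing p) ≠ 0 := by
    rw [qElt_sub_one]; exact PowerSeries.X_ne_zero
  apply mul_left_cancel₀ hX
  rw [mul_qNum, mul_geom_sum, PowerSeries.binomialSeries_nat, qElt]

end Base

/-! ## The operators `γ` and `d_q` on `R[[λ]]` -/

section Operators

variable {p : ℕ} [Fact p.Prime]

/-- The generator `γ` of `Γ` acting on `R[[λ]]`: the identity on `R`, and `γ(λ) = q λ`. -/
def gam : PowerSeries (BaseRing p) →+* PowerSeries (BaseRing p) :=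
  PowerSeries.rescale (qElt p)

/-- The `q`-differential operator `d_q = (γ - 1) / ((q - 1) λ)` on `R[[λ]]`, given on coefficients
by `d_q (λ ^ n) = [n]_q λ ^ (n - 1)`; see `mul_qDeriv`. -/
def qDeriv (f : PowerSeries (BaseRing p)) : PowerSeries (BaseRing p) :=
  PowerSeries.mk fun n => qNum ((n + 1 : ℕ) : ℤ_[p]) * PowerSeries.coeff (n + 1) f

/-- The defining property of `d_q` (`(q - 1) λ` is not a zero divisor in `R[[λ]]`). -/
theorem mul_qDeriv (f : PowerSeries (BaseRing p)) :
    PowerSeries.C (qElt p - 1) * PowerSeries.X * qDeriv f = gam f - f := by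
  ext1 n
  rw [mul_assoc, PowerSeries.coeff_C_mul]
  cases n with
  | zero =>
    rw [PowerSeries.coeff_zero_X_mul, mul_zero, map_sub, gam, PowerSeries.coeff_rescale, pow_zero,
      one_mul, sub_self]
  | succ n =>
    rw [PowerSeries.coeff_succ_X_mul, qDeriv, PowerSeries.coeff_mk, qNum_natCast, ← mul_assoc,
      mul_geom_sum, map_sub, gam, PowerSeries.coeff_rescale]
    ring

end Operators

/-! ## The ideal `(p, q - 1)` and the completed rings `R⟨λ, 1/g⟩` -/

section Completion

variable (p : ℕ) [Fact p.Prime]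

/-- The ideal `(p, q - 1)` of `R[[λ]]`. -/
def serIdeal : Ideal (PowerSeries (BaseRing p)) :=
  Ideal.span {(p : PowerSeries (BaseRing p)), PowerSeries.C (qElt p - 1)}

variable {p}

/-- The ideal `(p, q - 1)` of `R[λ, 1/g]`. -/
def locIdeal (g : Polynomial (BaseRing p)) : Ideal (Localization.Away g) :=
  Ideal.span {(p : Localization.Away g),
    algebraMap (Polynomial (BaseRing p)) (Localization.Away g) (Polynomial.C (qElt p - 1))}

/-- The ring `R⟨λ, 1/g⟩`: the `(p, q - 1)`-adic completion `lim_n R[λ, 1/g] / (p, q - 1) ^ n`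
of `R[λ, 1/g]`. It is an `R[λ]`-algebra. -/
abbrev CompRing (g : Polynomial (BaseRing p)) : Type :=
  AdicCompletion (locIdeal g) (Localization.Away g)

/-! ### `R[[λ]]` is `(p, q - 1)`-adically complete -/

theorem mem_map_C_pow {A : Type*} [CommRing A] {I : Ideal A} (hI : I.FG) (n : ℕ)
    (f : PowerSeries A) :
    f ∈ (I.map (PowerSeries.C (R := A))) ^ n ↔ ∀ k, PowerSeries.coeff k f ∈ I ^ n := by
  rw [← Ideal.map_pow]
  constructor
  · intro hf k
    refine Submodule.span_induction (p := fun f _ => PowerSeries.coeff k f ∈ I ^ n)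
      ?_ ?_ ?_ ?_ hf
    · rintro _ ⟨a, ha, rfl⟩
      rw [PowerSeries.coeff_C]
      split_ifs
      · exact ha
      · exact zero_mem _
    · simp
    · intro x y _ _ hx hy
      rw [map_add]
      exact add_mem hx hy
    · intro a x hx _
      -- every coefficient of a member of the extended ideal lies in the ideal
      have key : ∀ x ∈ (I ^ n).map (PowerSeries.C (R := A)), ∀ j,
          PowerSeries.coeff j x ∈ I ^ n := by
        intro x hx
        have : (I ^ n).map (PowerSeries.C (R := A)) ≤
            RingHom.ker (PowerSeries.map (Ideal.Quotient.mk (I ^ n))) := by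
          rw [Ideal.map_le_iff_le_comap]
          intro b hb
          rw [Ideal.mem_comap, RingHom.mem_ker, PowerSeries.map_C,
            Ideal.Quotient.eq_zero_iff_mem.mpr hb, map_zero]
        intro j
        have h2 := congrArg (PowerSeries.coeff j) (RingHom.mem_ker.mp (this hx))
        rw [PowerSeries.coeff_map, map_zero] at h2
        exact Ideal.Quotient.eq_zero_iff_mem.mp h2
      exact key (a • x) (Ideal.mul_mem_left _ _ hx) k
  · intro hf
    obtain ⟨S, hS⟩ := (hI.pow : (I ^ n).FG)
    have hc : ∀ k, ∃ c : A → A, ∑ a ∈ S, c a * a = PowerSeries.coeff k f := by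
      intro k
      have := hf k
      rw [← hS] at this
      obtain ⟨c, -, hc⟩ := Submodule.mem_span_finset.mp this
      exact ⟨c, by simpa using hc⟩
    choose c hc using hc
    have : f = ∑ a ∈ S, PowerSeries.mk (fun k => c k a) * PowerSeries.C a := by
      ext k
      rw [map_sum, ← hc k]
      simp
    rw [this]
    refine Ideal.sum_mem _ fun a ha => Ideal.mul_mem_left _ _ (Ideal.mem_map_of_mem _ ?_)
    rw [← hS]
    exact Ideal.subset_span ha

theorem isAdicComplete_map_C {A : Type*} [CommRing A] {I : Ideal A} (hI : I.FG)
    [IsAdicComplete I A] :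
    IsAdicComplete (I.map (PowerSeries.C (R := A))) (PowerSeries A) where
  haus' f hf := by
    ext k
    refine IsHausdorff.haus (I := I) inferInstance _ fun n => ?_
    have := hf n
    rw [SModEq.zero, smul_eq_mul, Ideal.mul_top, mem_map_C_pow hI] at this
    rw [SModEq.zero, smul_eq_mul, Ideal.mul_top]
    exact this k
  prec' f hf := by
    have h : ∀ k, ∃ L : A, ∀ n, PowerSeries.coeff k (f n) ≡ L [SMOD (I ^ n • ⊤ : Submodule A A)] := by
      intro k
      refine IsPrecomplete.prec inferInstance ?_
      intro m n hmn
      have := hf hmn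
      rw [SModEq.sub_mem, smul_eq_mul, Ideal.mul_top, mem_map_C_pow hI] at this
      rw [SModEq.sub_mem, smul_eq_mul, Ideal.mul_top, ← map_sub]
      exact this k
    choose L hL using h
    refine ⟨PowerSeries.mk L, fun n => ?_⟩
    rw [SModEq.sub_mem, smul_eq_mul, Ideal.mul_top, mem_map_C_pow hI]
    intro k
    have := hL k n
    rw [SModEq.sub_mem, smul_eq_mul, Ideal.mul_top] at this
    simpa using this

theorem mem_span_pair_pow {A : Type*} [CommRing A] (a : A) (n : ℕ) (f : PowerSeries A) :
    f ∈ (Ideal.span {PowerSeries.C a, PowerSeries.X}) ^ n ↔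
      ∀ k, PowerSeries.coeff k f ∈ (Ideal.span {a}) ^ (n - k) := by
  constructor
  · induction n generalizing f with
    | zero => simp
    | succ n ih =>
      intro hf
      rw [pow_succ] at hf
      refine Submodule.mul_induction_on hf ?_ ?_
      · intro x hx y hy k
        obtain ⟨u, v, rfl⟩ := Ideal.mem_span_pair.mp hy
        have hxk := ih x hx
        have e : x * (u * PowerSeries.C a + v * PowerSeries.X) =
            PowerSeries.C a * (x * u) + (x * v) * PowerSeries.X := by ring
        have hmul : ∀ w : PowerSeries A, ∀ j,
            PowerSeries.coeff j (x * w) ∈ (Ideal.span {a}) ^ (n - j) := by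
          intro w j
          rw [PowerSeries.coeff_mul]
          refine Ideal.sum_mem _ fun ij hij => Ideal.mul_mem_right _ _ ?_
          have hle : ij.1 ≤ j := by
            have := Finset.HasAntidiagonal.mem_antidiagonal.mp hij
            omega
          exact Ideal.pow_le_pow_right (by omega) (hxk ij.1)
        rw [e, map_add, PowerSeries.coeff_C_mul]
        refine add_mem ?_ ?_
        · refine Ideal.pow_le_pow_right (show n + 1 - k ≤ (n - k) + 1 by omega) ?_
          rw [pow_succ, mul_comm a]
          exact Ideal.mul_mem_mul (hmul u k) (Ideal.mem_span_singleton_self a)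
        · cases k with
          | zero => simp
          | succ k =>
            rw [PowerSeries.coeff_succ_mul_X]
            have := hmul v k
            rwa [Nat.add_sub_add_right]
      · intro x y hx hy k
        rw [map_add]
        exact add_mem (hx k) (hy k)
  · intro hf
    have hsplit : f = PowerSeries.X ^ n * PowerSeries.mk (fun i => PowerSeries.coeff (i + n) f) +
        (PowerSeries.trunc n f : PowerSeries A) := by
      rw [mul_comm]
      exact PowerSeries.eq_X_pow_mul_shift_add_trunc n f |>.trans (by rw [mul_comm])
    have hX : (PowerSeries.X : PowerSeries A) ∈ Ideal.span {PowerSeries.C a, PowerSeries.X} :=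
      Ideal.subset_span (by simp)
    have ha : (PowerSeries.C a : PowerSeries A) ∈ Ideal.span {PowerSeries.C a, PowerSeries.X} :=
      Ideal.subset_span (by simp)
    rw [hsplit]
    refine add_mem (Ideal.mul_mem_right _ _ (Ideal.pow_mem_pow hX n)) ?_
    rw [PowerSeries.trunc_apply, ← Polynomial.coeToPowerSeries.ringHom_apply, map_sum]
    refine Ideal.sum_mem _ fun k hk => ?_
    have hk' : k < n := by simpa using hk
    rw [Polynomial.coeToPowerSeries.ringHom_apply, Polynomial.coe_monomial,
      PowerSeries.monomial_eq_C_mul_X_pow]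
    have := hf k
    rw [Ideal.span_singleton_pow, Ideal.mem_span_singleton'] at this
    obtain ⟨b, hb⟩ := this
    rw [← hb, map_mul, map_pow, mul_assoc]
    refine Ideal.mul_mem_left _ _ ?_
    have := Ideal.mul_mem_mul (Ideal.pow_mem_pow ha (n - k)) (Ideal.pow_mem_pow hX k)
    rwa [← pow_add, Nat.sub_add_cancel hk'.le] at this

theorem isAdicComplete_span_pair {A : Type*} [CommRing A] (a : A)
    [IsAdicComplete (Ideal.span {a}) A] :
    IsAdicComplete (Ideal.span {PowerSeries.C a, PowerSeries.X}) (PowerSeries A) where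
  haus' f hf := by
    ext k
    refine IsHausdorff.haus (I := Ideal.span {a}) inferInstance _ fun n => ?_
    have := hf (n + k)
    rw [SModEq.zero, smul_eq_mul, Ideal.mul_top, mem_span_pair_pow] at this
    rw [SModEq.zero, smul_eq_mul, Ideal.mul_top]
    simpa using this k
  prec' f hf := by
    have h : ∀ k, ∃ L : A, ∀ n, PowerSeries.coeff k (f (n + k)) ≡ L
        [SMOD ((Ideal.span {a}) ^ n • ⊤ : Submodule A A)] := by
      intro k
      refine IsPrecomplete.prec (f := fun n => PowerSeries.coeff k (f (n + k))) inferInstance ?_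
      intro m n hmn
      have := hf (Nat.add_le_add_right hmn k)
      rw [SModEq.sub_mem, smul_eq_mul, Ideal.mul_top, mem_span_pair_pow] at this
      rw [SModEq.sub_mem, smul_eq_mul, Ideal.mul_top, ← map_sub]
      simpa using this k
    choose L hL using h
    refine ⟨PowerSeries.mk L, fun n => ?_⟩
    rw [SModEq.sub_mem, smul_eq_mul, Ideal.mul_top, mem_span_pair_pow]
    intro k
    rcases le_total n k with hnk | hnk
    · simp [Nat.sub_eq_zero_of_le hnk]
    · have := hL k (n - k)
      rw [Nat.sub_add_cancel hnk, SModEq.sub_mem, smul_eq_mul, Ideal.mul_top] at this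
      simpa using this

variable (p)

instance isAdicComplete_serIdeal :
    IsAdicComplete (serIdeal p) (PowerSeries (BaseRing p)) := by
  have h1 : IsAdicComplete (Ideal.span {(p : ℤ_[p])}) ℤ_[p] := by
    rw [← PadicInt.maximalIdeal_eq_span_p]; infer_instance
  have h2 := isAdicComplete_span_pair (p : ℤ_[p])
  have hfg : (Ideal.span {PowerSeries.C (p : ℤ_[p]), PowerSeries.X}).FG :=
    Submodule.fg_span (Set.toFinite _)
  have h3 := isAdicComplete_map_C hfg
  have e : (Ideal.span {PowerSeries.C (p : ℤ_[p]), PowerSeries.X}).map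
      (PowerSeries.C (R := BaseRing p)) = serIdeal p := by
    rw [Ideal.map_span, Set.image_pair, serIdeal, qElt_sub_one, map_natCast, map_natCast]
  rwa [e] at h3

variable {p}

/-! ### The canonical homomorphism `R⟨λ, 1/g⟩ → R[[λ]]` for `g(0) = 1` -/

theorem isUnit_coe {g : Polynomial (BaseRing p)} (hg : g.coeff 0 = 1) :
    IsUnit (Polynomial.coeToPowerSeries.ringHom (R := BaseRing p) g) := by
  rw [PowerSeries.isUnit_iff_constantCoeff]
  simp [hg]

/-- The inclusion `R[λ] ⊂ R[[λ]]` extended to `R[λ, 1/g]`. -/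
def locToSeries (g : Polynomial (BaseRing p)) (hg : g.coeff 0 = 1) :
    Localization.Away g →+* PowerSeries (BaseRing p) :=
  IsLocalization.Away.lift g (g := Polynomial.coeToPowerSeries.ringHom (R := BaseRing p))
    (isUnit_coe hg)

theorem locIdeal_pow_le (g : Polynomial (BaseRing p)) (hg : g.coeff 0 = 1) (n : ℕ) :
    locIdeal g ^ n ≤ (serIdeal p ^ n).comap (locToSeries g hg) := by
  have h : locIdeal g ≤ (serIdeal p).comap (locToSeries g hg) := by
    rw [locIdeal, Ideal.span_le]
    rintro x (rfl | rfl)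
    · simp only [SetLike.mem_coe, Ideal.mem_comap, map_natCast]
      exact Ideal.subset_span (by simp)
    · simp only [SetLike.mem_coe, Ideal.mem_comap, locToSeries, IsLocalization.Away.lift_eq]
      refine Ideal.subset_span ?_
      right
      simp
  exact (Ideal.pow_right_mono h n).trans (Ideal.le_comap_pow _ n)

/-- The reduction `R⟨λ, 1/g⟩ → R[[λ]] / (p, q - 1) ^ n` induced by `R[λ, 1/g] → R[[λ]]`. -/
def expandMod (g : Polynomial (BaseRing p)) (hg : g.coeff 0 = 1) (n : ℕ) :
    CompRing g →+* PowerSeries (BaseRing p) ⧸ serIdeal p ^ n :=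
  (Ideal.quotientMap (serIdeal p ^ n) (locToSeries g hg) (locIdeal_pow_le g hg n)).comp
    (AdicCompletion.evalₐ (locIdeal g) n : CompRing g →+* Localization.Away g ⧸ locIdeal g ^ n)

theorem expandMod_compat (g : Polynomial (BaseRing p)) (hg : g.coeff 0 = 1) {m n : ℕ}
    (hle : m ≤ n) :
    (Ideal.Quotient.factorPow (serIdeal p) hle).comp (expandMod g hg n) = expandMod g hg m := by
  ext1 t
  induction t using AdicCompletion.induction_on with
  | _ x =>
    simp only [expandMod, RingHom.comp_apply, RingHom.coe_coe, AdicCompletion.evalₐ_mk,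
      Ideal.quotientMap_mk]
    have h := congrArg (Ideal.quotientMap (serIdeal p ^ m) (locToSeries g hg)
      (locIdeal_pow_le g hg m)) (AdicCompletion.Ideal.mk_eq_mk (locIdeal g) hle x)
    rw [Ideal.quotientMap_mk, Ideal.quotientMap_mk] at h
    exact h

/-- The canonical homomorphism `R⟨λ, 1/g⟩ → R[[λ]]` for `g(0) = 1`: the extension by continuity
of `R[λ, 1/g] → R[[λ]]`, which exists since `R[[λ]]` is `(p, q - 1)`-adically complete. -/
def expand (g : Polynomial (BaseRing p)) (hg : g.coeff 0 = 1) :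
    CompRing g →+* PowerSeries (BaseRing p) :=
  IsAdicComplete.liftRingHom (serIdeal p) (expandMod g hg) (expandMod_compat g hg)

/-- On `R[λ, 1/g]` it is the map above. -/
theorem expand_of (g : Polynomial (BaseRing p)) (hg : g.coeff 0 = 1) (x : Localization.Away g) :
    expand g hg (AdicCompletion.of (locIdeal g) (Localization.Away g) x) = locToSeries g hg x := by
  refine IsHausdorff.eq_iff_smodEq (I := serIdeal p) |>.mpr fun n => ?_
  rw [smul_eq_mul, Ideal.mul_top, SModEq.sub_mem, ← Ideal.Quotient.eq, expand,
    IsAdicComplete.mk_liftRingHom, expandMod]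
  simp

end Completion

/-! ## The hypotheses on the sequence of coefficients, and the `q`-hypergeometric series -/

section Sequences

variable (p : ℕ) [Fact p.Prime]

/-- The quotient field `Q` of `R`. -/
abbrev QuotField : Type := FractionRing (BaseRing p)

variable {p}

/-- The quotient `B(n) / φ(B(m))` in `Q`. -/
def frobQuot (B : ℕ → BaseRing p) (n m : ℕ) : QuotField p :=
  algebraMap (BaseRing p) (QuotField p) (B n) /
    algebraMap (BaseRing p) (QuotField p) (frob p (B m))

/-- The conditions on a sequence `B : ℕ → R` under which the formal congruences hold. -/
structure DworkConditions (B : ℕ → BaseRing p) : Prop where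
  /-- The quotients in the next two conditions make sense. -/
  ne_zero : ∀ n, B n ≠ 0
  /-- `B(n + m p^{s+1}) / φ(B(⌊n/p⌋ + m p^s)) ≡ B(n) / φ(B(⌊n/p⌋))` modulo `[p^{s+1}]_q R`. -/
  congr : ∀ n m s : ℕ, ∃ c : BaseRing p,
    frobQuot B (n + m * p ^ (s + 1)) (n / p + m * p ^ s) - frobQuot B n (n / p) =
      algebraMap (BaseRing p) (QuotField p) (qNum ((p ^ (s + 1) : ℕ) : ℤ_[p]) * c)
  /-- `B(n) / φ(B(⌊n/p⌋)) ∈ R`. -/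
  integral : ∀ n : ℕ, ∃ c : BaseRing p,
    frobQuot B n (n / p) = algebraMap (BaseRing p) (QuotField p) c
  /-- `B(0) = 1`. -/
  zero_eq_one : B 0 = 1

theorem trunc_coeff_zero {B : ℕ → BaseRing p} (h : B 0 = 1) :
    (PowerSeries.trunc p (PowerSeries.mk B)).coeff 0 = 1 := by
  rw [PowerSeries.coeff_trunc, if_pos (Fact.out : p.Prime).pos, PowerSeries.coeff_mk, h]

variable (p)

/-- The `p`-adic integer `1/2` (for `p` odd). -/
def half : ℤ_[p] := Ring.inverse 2

theorem two_mul_half (hp : Odd p) : 2 * half p = 1 := by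
  refine Ring.mul_inverse_cancel _ ?_
  have : IsUnit ((2 : ℕ) : ℤ_[p]) := by
    rw [PadicInt.isUnit_iff]
    rw [PadicInt.norm_natCast_eq_one_iff]
    exact (Nat.coprime_two_right).mpr hp
  exact_mod_cast this

/-- The coefficient `a_n = ∏_{i < n} ([i + 1/2]_q / [i + 1]_q) ^ 2 ∈ Q` of the `q`-hypergeometric
series with parameters `(q^{1/2}, q^{1/2}; q)`. -/
def hypCoeff (n : ℕ) : QuotField p :=
  ∏ i ∈ Finset.range n,
    (algebraMap (BaseRing p) (QuotField p) (qNum ((i : ℤ_[p]) + half p)) /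
      algebraMap (BaseRing p) (QuotField p) (qNum ((i : ℤ_[p]) + 1))) ^ 2

/-- The Hasse polynomial `h(λ) = ∑_{i=0}^{(p-1)/2} ((p-1)/2 choose i)^2 λ^i`, in `R[λ]`. -/
def hasse : Polynomial (BaseRing p) :=
  ∑ i ∈ Finset.range ((p - 1) / 2 + 1),
    Polynomial.C ((((p - 1) / 2).choose i ^ 2 : ℕ) : BaseRing p) * Polynomial.X ^ i

theorem hasse_coeff_zero : (hasse p).coeff 0 = 1 := by
  simp [hasse, Polynomial.finsetSum_coeff, Polynomial.coeff_X_pow, Finset.sum_range_succ']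

end Sequences

end QDwork

end

/-! Write `F_s` for the truncation of `F` at degree `p ^ s` and extend `φ` to `R[[λ]]` by `λ ↦ λ ^
p`. Part (1) rests on Dwork's congruence with `q`-numbers as moduli, `F φ(F_s) ≡ φ(F) F_{s+1}` mod
`[p^{s+1}]_q` (`formal_congruence`). It is used twice. Modulo `(p, q - 1)` the map `φ` is the `p`-th
power, so `F_{s+1} ≡ F_1 F_s ^ p`. Each `F_s` is therefore congruent to a power of `F_1` and is
invertible in `T` (`exists_trunc_sub_pow_mem`, `inverse_mem_range`). The quotients `H_s = F / F_s`
satisfy `H_{s+1} ≡ φ(H_s)` mod `[p^{s+1}]_q`. Since `d_q φ(f) = [p]_q λ^{p-1} φ(d_q f)`, induction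
shows that `[p^s]_q` divides `d_q H_s` (`exists_eq_mul_trunc`). By the `q`-Leibniz rule `d_q F / F ≡
d_q F_s / F_s` mod `[p^s]_q`, which lies in `(p, q - 1) ^ s`. So `d_q F / F` is a limit of elements
of `T`, and `T` is closed in `R[[λ]]` (`mem_range_expand_iff`). The quotient by `γ(F)` is treated in
the same way. For part (2), `T` depends only on `F_1` modulo `(p, q - 1)`. The square roots of the
`a_n` are integral by a `q`-Vandermonde identity. They reduce to `(-1)^n` times the binomial
coefficients of `(p - 1) / 2`, and squaring gives `F_1 ≡ h`. -/

namespace QDwork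

open PowerSeries

/-! ## Formal congruences of Dwork type -/

section FormalCongruences

theorem map_dvd_of_C_dvd {A : Type*} [CommRing A] (φ : A →+* A) {x : A} {f : PowerSeries A}
    (h : C x ∣ f) : C (φ x) ∣ PowerSeries.map φ f := by
  rw [← PowerSeries.map_C]
  exact map_dvd _ h

theorem expand_dvd_of_C_dvd {A : Type*} [CommRing A] {p : ℕ} (hp : p ≠ 0) {x : A}
    {f : PowerSeries A} (h : C x ∣ f) : C x ∣ PowerSeries.expand p hp f := by
  have := map_dvd (PowerSeries.expand p hp (R := A)) h
  rwa [PowerSeries.expand_C] at this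

/-- A power series is the sum of its parts of degrees in the residue classes modulo `p`. -/
theorem eq_sum_X_pow_mul_expand {A : Type*} [CommRing A] {p : ℕ} (hp : p ≠ 0)
    (f : PowerSeries A) :
    f = ∑ a ∈ Finset.range p,
      X ^ a * PowerSeries.expand p hp (mk fun m => coeff (a + p * m) f) := by
  ext n
  rw [map_sum, Finset.sum_eq_single_of_mem (n % p)
    (Finset.mem_range.mpr (Nat.mod_lt _ (Nat.pos_of_ne_zero hp)))]
  · rw [coeff_X_pow_mul', if_pos (Nat.mod_le _ _), coeff_expand, if_pos (Nat.dvd_sub_mod n),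
      coeff_mk, Nat.mul_div_cancel' (Nat.dvd_sub_mod n), Nat.add_sub_cancel' (Nat.mod_le _ _)]
  · intro a ha hne
    rw [coeff_X_pow_mul']
    split_ifs with h
    · rw [coeff_expand, if_neg]
      intro hd
      apply hne
      rw [Finset.mem_range] at ha
      obtain ⟨k, hk⟩ := hd
      rw [show n = a + p * k by omega, Nat.add_mul_mod_self_left, Nat.mod_eq_of_lt ha]
    · rfl

variable {A : Type*} [CommRing A]

/-- The defect of the proportionality, between the series with coefficients `w` and its truncation
at `N`, of the parts weighted by `ψ`. -/
noncomputable def bracket (w : ℕ → A) (N : ℕ) (ψ : ℕ → A) : PowerSeries A :=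
  mk (fun j => ψ j * w j) * (trunc N (mk w) : Polynomial A) -
    mk w * (trunc N (mk fun j => ψ j * w j) : Polynomial A)

theorem coe_trunc_eq_mk (N : ℕ) (f : ℕ → A) :
    ((trunc N (mk f) : Polynomial A) : PowerSeries A) = mk fun j => if j < N then f j else 0 := by
  ext j
  rw [Polynomial.coeff_coe, coeff_trunc, coeff_mk, coeff_mk]

theorem bracket_add (w : ℕ → A) (N : ℕ) (ψ χ : ℕ → A) :
    bracket w N (ψ + χ) = bracket w N ψ + bracket w N χ := by
  have h : mk (fun j => (ψ + χ) j * w j) = mk (fun j => ψ j * w j) + mk (fun j => χ j * w j) := by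
    ext j
    simp [add_mul]
  simp only [bracket, h, map_add, Polynomial.coe_add]
  ring

theorem bracket_smul (w : ℕ → A) (N : ℕ) (x : A) (ψ : ℕ → A) :
    bracket w N (fun j => x * ψ j) = C x * bracket w N ψ := by
  have h : mk (fun j => x * ψ j * w j) = C x * mk (fun j => ψ j * w j) := by
    ext j
    simp [mul_assoc]
  have h2 : ((trunc N (C x * mk (fun j => ψ j * w j)) : Polynomial A) : PowerSeries A) =
      C x * (trunc N (mk (fun j => ψ j * w j)) : Polynomial A) := by
    rw [trunc_C_mul, Polynomial.coe_mul, Polynomial.coe_C]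
  simp only [bracket, h, h2]
  ring

theorem bracket_sum {ι : Type*} (w : ℕ → A) (N : ℕ) (S : Finset ι) (ψ : ι → ℕ → A) :
    bracket w N (fun j => ∑ i ∈ S, ψ i j) = ∑ i ∈ S, bracket w N (ψ i) := by
  classical
  induction S using Finset.induction_on with
  | empty => simpa using bracket_smul w N 0 (fun _ => 0)
  | insert i S hi ih =>
    rw [Finset.sum_insert hi, ← ih, ← bracket_add]
    congr 1
    ext j
    simp [Finset.sum_insert hi]

theorem bracket_const (w : ℕ → A) (N : ℕ) (x : A) : bracket w N (fun _ => x) = 0 := by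
  have h := bracket_smul w N x (fun _ => 1)
  simp only [mul_one] at h
  rw [h]
  simp [bracket, mul_comm]

theorem dvd_bracket (w : ℕ → A) (N : ℕ) {x : A} {ψ : ℕ → A} (h : ∀ j, x ∣ ψ j) :
    C x ∣ bracket w N ψ := by
  choose χ hχ using h
  obtain rfl : ψ = fun j => x * χ j := funext hχ
  rw [bracket_smul]
  exact dvd_mul_right _ _

theorem map_bracket (φ : A →+* A) (w : ℕ → A) (N : ℕ) (ψ : ℕ → A) :
    PowerSeries.map φ (bracket w N ψ) = bracket (fun j => φ (w j)) N (fun j => φ (ψ j)) := by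
  have h1 : ∀ f : ℕ → A, PowerSeries.map φ (mk f) = mk fun j => φ (f j) := by
    intro f
    ext j
    simp
  have h2 : ∀ f : ℕ → A, PowerSeries.map φ (trunc N (mk f) : Polynomial A) =
      (trunc N (mk fun j => φ (f j)) : Polynomial A) := by
    intro f
    rw [coe_trunc_eq_mk, coe_trunc_eq_mk, h1]
    congr 1
    ext j
    split_ifs <;> simp
  simp only [bracket, map_sub, map_mul, h1, h2]

/-- The Frobenius `λ ↦ λ ^ p` on `A[[λ]]` lifting an endomorphism `φ` of `A`. -/
noncomputable def serFrob (φ : A →+* A) (p : ℕ) (hp : p ≠ 0) : PowerSeries A →+* PowerSeries A :=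
  (PowerSeries.expand p hp : PowerSeries A →ₐ[A] PowerSeries A).toRingHom.comp (PowerSeries.map φ)

theorem serFrob_mk (φ : A →+* A) (p : ℕ) (hp : p ≠ 0) (B : ℕ → A) :
    serFrob φ p hp (mk B) = PowerSeries.expand p hp (mk fun j => φ (B j)) := by
  rw [serFrob, RingHom.comp_apply]
  refine congrArg (PowerSeries.expand p hp) ?_
  ext j
  simp

theorem serFrob_trunc (φ : A →+* A) (p : ℕ) (hp : p ≠ 0) (B : ℕ → A) (N : ℕ) :
    serFrob φ p hp (trunc N (mk B) : Polynomial A) =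
      PowerSeries.expand p hp (trunc N (mk fun j => φ (B j)) : Polynomial A) := by
  rw [coe_trunc_eq_mk, coe_trunc_eq_mk, serFrob_mk]
  congr 2
  ext j
  split_ifs <;> simp

/-- The data of the formal congruences: moduli `M s t`, playing the role of
`[p ^ s]_q / [p ^ t]_q`, and a sequence `B` whose Frobenius quotients `c` are continuous. -/
structure FrobContinuous (φ : A →+* A) (p : ℕ) (M : ℕ → ℕ → A) (c B : ℕ → A) : Prop where
  map_modulus : ∀ s t, φ (M s t) = M (s + 1) (t + 1)
  modulus_mul : ∀ s t, t ≤ s → M t 0 * M s t = M s 0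
  eq_mul : ∀ n, B n = c n * φ (B (n / p))
  quot_congr : ∀ n m s, M s 0 ∣ c (n + m * p ^ s) - c n
  zero_eq_one : B 0 = 1

variable {φ : A →+* A} {p : ℕ} {M : ℕ → ℕ → A} {c B : ℕ → A}

/-- Telescope the continuous factor `κ` along its values at `j % p ^ u`, for `u` from `t` to `s`.
The increment from `u` to `u + 1` is `M (u + 1) 0` times a weight depending on `j` mod `p ^ (u +
1)`, and `hs` at that level supplies the complementary factor `M (s + 1) (u + 1)`. -/
theorem dvd_bracket_mul (w : ℕ → A) (hM : ∀ s t, t ≤ s → M t 0 * M s t = M s 0)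
    (s : ℕ)
    (hs : ∀ t ≤ s, ∀ ψ : ℕ → A, (∀ j, ψ j = ψ (j % p ^ t)) →
      C (M (s + 1) t) ∣ bracket w (p ^ s) ψ)
    (κ : ℕ → A) (hκ : ∀ u j, M (u + 1) 0 ∣ κ j - κ (j % p ^ u))
    (t : ℕ) (ht : t ≤ s) (ψ : ℕ → A) (hψ : ∀ j, ψ j = ψ (j % p ^ t)) :
    C (M (s + 1) t) ∣ bracket w (p ^ s) (fun j => ψ j * κ j) := by
  have hdvd : M (s + 1) t ∣ M (s + 1) 0 := ⟨M t 0, by rw [← hM (s + 1) t (by omega), mul_comm]⟩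
  have hlev : ∀ u, t ≤ u → ∀ j, ψ (j % p ^ u) = ψ j := fun u hu j => by
    rw [hψ (j % p ^ u), Nat.mod_mod_of_dvd _ (pow_dvd_pow p hu), ← hψ]
  have key : ∀ u, t ≤ u → u ≤ s →
      C (M (s + 1) t) ∣ bracket w (p ^ s) (fun j => ψ j * κ (j % p ^ u)) := by
    intro u hu
    induction u, hu using Nat.le_induction with
    | base =>
      intro _
      refine hs t ht _ fun j => ?_
      rw [Nat.mod_mod, ← hψ]
    | succ u hu ih =>
      intro hus
      have hχ : ∀ j, ∃ x, ψ (j % p ^ (u + 1)) * (κ (j % p ^ (u + 1)) - κ (j % p ^ u)) =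
          M (u + 1) 0 * x := by
        intro j
        have h := hκ u (j % p ^ (u + 1))
        rw [Nat.mod_mod_of_dvd _ (pow_dvd_pow p (Nat.le_succ u))] at h
        exact h.mul_left _
      choose χ hχ using hχ
      have e : (fun j => ψ j * κ (j % p ^ (u + 1))) = (fun j => ψ j * κ (j % p ^ u)) +
          fun j => M (u + 1) 0 * χ (j % p ^ (u + 1)) := by
        ext j
        rw [Pi.add_apply, ← hχ, Nat.mod_mod, Nat.mod_mod_of_dvd _ (pow_dvd_pow p (Nat.le_succ u)),
          hlev (u + 1) (by omega)]
        ring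
      rw [e, bracket_add, bracket_smul]
      refine dvd_add (ih (by omega)) ?_
      refine dvd_trans (map_dvd C hdvd) ?_
      rw [← hM (s + 1) (u + 1) (by omega), map_mul]
      refine mul_dvd_mul_left _ (hs (u + 1) hus _ fun j => ?_)
      rw [Nat.mod_mod]
  -- The last remainder is divisible by `M (s + 1) 0` pointwise, so it needs no bracket congruence.
  have e : (fun j => ψ j * κ j) = (fun j => ψ j * κ (j % p ^ s)) +
      fun j => ψ j * (κ j - κ (j % p ^ s)) := by
    ext j
    rw [Pi.add_apply]
    ring
  rw [e, bracket_add]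
  refine dvd_add (key s ht le_rfl) (dvd_bracket _ _ fun j => hdvd.trans ((hκ s j).mul_left _))

/-- Split degrees as `a + p * m` with `a < p`. There `B (a + p * m) = c (a + p * m) * φ (B m)`, so
`c` joins the weight, and truncation at `p ^ (s + 1)` becomes truncation at `p ^ s` in `m`. -/
theorem mul_serFrob_trunc_sub (h : FrobContinuous φ p M c B) (hp : p ≠ 0) (s : ℕ)
    (ψ : ℕ → A) :
    mk (fun j => ψ j * B j) * serFrob φ p hp (trunc (p ^ s) (mk B) : Polynomial A) -
      serFrob φ p hp (mk B) * (trunc (p ^ (s + 1)) (mk fun j => ψ j * B j) : Polynomial A) =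
    ∑ a ∈ Finset.range p, X ^ a * PowerSeries.expand p hp
      (bracket (fun j => φ (B j)) (p ^ s) fun m => ψ (a + p * m) * c (a + p * m)) := by
  have hB : ∀ a < p, ∀ m, B (a + p * m) = c (a + p * m) * φ (B m) := by
    intro a ha m
    rw [h.eq_mul (a + p * m), Nat.add_mul_div_left _ _ (Nat.pos_of_ne_zero hp),
      Nat.div_eq_of_lt ha, zero_add]
  rw [serFrob_mk, serFrob_trunc, coe_trunc_eq_mk (p ^ (s + 1)),
    eq_sum_X_pow_mul_expand hp (mk fun j => ψ j * B j),
    eq_sum_X_pow_mul_expand hp (mk fun j => if j < p ^ (s + 1) then ψ j * B j else 0),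
    Finset.sum_mul, Finset.mul_sum, ← Finset.sum_sub_distrib]
  refine Finset.sum_congr rfl fun a ha => ?_
  have ha' := Finset.mem_range.mp ha
  have e1 : (mk fun m => coeff (a + p * m) (mk fun j => ψ j * B j)) =
      mk fun m => ψ (a + p * m) * c (a + p * m) * φ (B m) := by
    ext m
    simp only [coeff_mk]
    rw [hB a ha', mul_assoc]
  have e2 : (mk fun m => coeff (a + p * m)
      (mk fun j => if j < p ^ (s + 1) then ψ j * B j else 0)) =
      (trunc (p ^ s) (mk fun m => ψ (a + p * m) * c (a + p * m) * φ (B m)) : Polynomial A) := by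
    rw [coe_trunc_eq_mk]
    ext m
    simp only [coeff_mk]
    have : a + p * m < p ^ (s + 1) ↔ m < p ^ s := by
      rw [pow_succ']
      constructor
      · intro hlt
        exact lt_of_mul_lt_mul_left (lt_of_le_of_lt (Nat.le_add_left _ _) hlt) (Nat.zero_le p)
      · intro hlt
        calc a + p * m < p + p * m := by omega
          _ = p * (m + 1) := by ring
          _ ≤ p * p ^ s := Nat.mul_le_mul_left _ hlt
    simp only [this, hB a ha', mul_assoc]
  rw [e1, e2, bracket, map_sub, map_mul, map_mul]
  ring

theorem isUnit_serFrob_trunc (φ : A →+* A) {p : ℕ} (hp : p ≠ 0) {B : ℕ → A} (h0 : B 0 = 1)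
    {N : ℕ} (hN : 0 < N) :
    IsUnit (serFrob φ p hp (trunc N (mk B) : Polynomial A)) := by
  rw [serFrob_trunc, PowerSeries.isUnit_iff_constantCoeff, constantCoeff_expand, coe_trunc_eq_mk,
    ← coeff_zero_eq_constantCoeff_apply, coeff_mk, if_pos hN, h0, map_one]
  exact isUnit_one

/-- Induction on `s`: splitting modulo `p` passes from `φ ∘ B` at `p ^ s` to `B` at `p ^ (s + 1)`,
and applying `φ` returns to `φ ∘ B` while raising both indices of the modulus. Weights of level `0`
are constant, so their bracket vanishes. -/
theorem dvd_bracket_of_level (h : FrobContinuous φ p M c B) (hp : p ≠ 0) (s : ℕ) :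
    ∀ t ≤ s, ∀ ψ : ℕ → A, (∀ j, ψ j = ψ (j % p ^ t)) →
      C (M (s + 1) t) ∣ bracket (fun j => φ (B j)) (p ^ s) ψ := by
  induction s with
  | zero =>
    intro t ht ψ hψ
    obtain rfl : t = 0 := by omega
    obtain ⟨x, rfl⟩ : ∃ x, ψ = fun _ => x := by
      refine ⟨ψ 0, funext fun j => ?_⟩
      rw [hψ j, pow_zero, Nat.mod_one]
    rw [bracket_const]
    exact dvd_zero _
  | succ s ih =>
    have hκ : ∀ a u j, M (u + 1) 0 ∣ c (a + p * j) - c (a + p * (j % p ^ u)) := by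
      intro a u j
      have := h.quot_congr (a + p * (j % p ^ u)) (j / p ^ u) (u + 1)
      have e : a + p * (j % p ^ u) + j / p ^ u * p ^ (u + 1) = a + p * j := by
        conv_rhs => rw [← Nat.mod_add_div j (p ^ u)]
        ring
      rwa [e] at this
    have hdiff : ∀ t ≤ s, ∀ ψ : ℕ → A, (∀ j, ψ j = ψ (j % p ^ (t + 1))) →
        C (M (s + 1) t) ∣ mk (fun j => ψ j * B j) *
            serFrob φ p hp (trunc (p ^ s) (mk B) : Polynomial A) -
          serFrob φ p hp (mk B) *
            (trunc (p ^ (s + 1)) (mk fun j => ψ j * B j) : Polynomial A) := by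
      intro t ht ψ hψ
      rw [mul_serFrob_trunc_sub h hp s ψ]
      refine Finset.dvd_sum fun a ha => Dvd.dvd.mul_left (expand_dvd_of_C_dvd hp ?_) _
      have ha' := Finset.mem_range.mp ha
      refine dvd_bracket_mul _ h.modulus_mul s ih (fun m => c (a + p * m)) (hκ a) t ht
        (fun m => ψ (a + p * m)) fun m => ?_
      have e : (a + p * m) % p ^ (t + 1) = (a + p * (m % p ^ t)) % p ^ (t + 1) := by
        conv_lhs => rw [← Nat.mod_add_div m (p ^ t)]
        rw [show a + p * (m % p ^ t + p ^ t * (m / p ^ t)) =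
          a + p * (m % p ^ t) + p ^ (t + 1) * (m / p ^ t) by ring, Nat.add_mul_mod_self_left]
      rw [hψ (a + p * m), e, ← hψ]
    -- The relations for the weights `ψ` and `1` share the factor `serFrob φ p hp (mk B)`.
    -- Cross-multiplication eliminates it and leaves the bracket times a unit.
    have hmain : ∀ t ≤ s, ∀ ψ : ℕ → A, (∀ j, ψ j = ψ (j % p ^ (t + 1))) →
        C (M (s + 1) t) ∣ bracket B (p ^ (s + 1)) ψ := by
      intro t ht ψ hψ
      have hdvd : M (s + 1) t ∣ M (s + 1) 0 :=
        ⟨M t 0, by rw [← h.modulus_mul (s + 1) t (by omega), mul_comm]⟩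
      have h1 := hdiff t ht ψ hψ
      have h2 := hdiff 0 (Nat.zero_le _) (fun _ => 1) fun _ => rfl
      simp only [one_mul] at h2
      have hu := isUnit_serFrob_trunc φ hp h.zero_eq_one
        (pow_pos (Nat.pos_of_ne_zero hp) s : 0 < p ^ s)
      rw [← hu.dvd_mul_right]
      have e : bracket B (p ^ (s + 1)) ψ *
          serFrob φ p hp (trunc (p ^ s) (mk B) : Polynomial A) =
          (mk (fun j => ψ j * B j) * serFrob φ p hp (trunc (p ^ s) (mk B) : Polynomial A) -
            serFrob φ p hp (mk B) *
              (trunc (p ^ (s + 1)) (mk fun j => ψ j * B j) : Polynomial A)) *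
            (trunc (p ^ (s + 1)) (mk B) : Polynomial A) -
          (mk B * serFrob φ p hp (trunc (p ^ s) (mk B) : Polynomial A) -
            serFrob φ p hp (mk B) * (trunc (p ^ (s + 1)) (mk B) : Polynomial A)) *
            (trunc (p ^ (s + 1)) (mk fun j => ψ j * B j) : Polynomial A) := by
        rw [bracket]
        ring
      rw [e]
      exact dvd_sub (h1.mul_right _) (((map_dvd C hdvd).trans h2).mul_right _)
    intro t ht ψ hψ
    cases t with
    | zero =>
      obtain ⟨x, rfl⟩ : ∃ x, ψ = fun _ => x := by
        refine ⟨ψ 0, funext fun j => ?_⟩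
        rw [hψ j, pow_zero, Nat.mod_one]
      rw [bracket_const]
      exact dvd_zero _
    | succ t =>
      -- The values of `ψ` need not lie in the image of `φ`. Indicator functions of residue classes
      -- have values `0` and `1`, which `φ` fixes, so `map_bracket` applies to them.
      have e : ψ = fun j => ∑ r ∈ Finset.range (p ^ (t + 1)),
          ψ r * φ (if j % p ^ (t + 1) = r then 1 else 0) := by
        ext j
        rw [Finset.sum_eq_single_of_mem (j % p ^ (t + 1))
          (Finset.mem_range.mpr (Nat.mod_lt _ (pow_pos (Nat.pos_of_ne_zero hp) _)))]
        · rw [if_pos rfl, map_one, mul_one, ← hψ]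
        · intro r _ hr
          rw [if_neg hr.symm, map_zero, mul_zero]
      rw [e, bracket_sum]
      refine Finset.dvd_sum fun r _ => ?_
      rw [bracket_smul, ← map_bracket φ B (p ^ (s + 1)) (fun j => if j % p ^ (t + 1) = r then 1 else 0),
        ← h.map_modulus]
      refine Dvd.dvd.mul_left (map_dvd_of_C_dvd φ (hmain t (by omega) _ fun j => ?_)) _
      rw [Nat.mod_mod]

/-- The formal congruence `F(λ) φ(F_{s})(λ ^ p) ≡ φ(F)(λ ^ p) F_{s + 1}(λ)`, where
`F_s` is the truncation of `F` at degree `p ^ s`. -/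
theorem formal_congruence (h : FrobContinuous φ p M c B) (hp : p ≠ 0) (s : ℕ) :
    C (M (s + 1) 0) ∣
      mk B * serFrob φ p hp (trunc (p ^ s) (mk B) : Polynomial A) -
        serFrob φ p hp (mk B) * (trunc (p ^ (s + 1)) (mk B) : Polynomial A) := by
  have h1 := mul_serFrob_trunc_sub h hp s (fun _ => 1)
  simp only [one_mul] at h1
  rw [h1]
  refine Finset.dvd_sum fun a _ => Dvd.dvd.mul_left (expand_dvd_of_C_dvd hp ?_) _
  have := dvd_bracket_mul (fun j => φ (B j)) h.modulus_mul s
    (dvd_bracket_of_level h hp s) (fun m => c (a + p * m)) (fun u j => ?_) 0 (Nat.zero_le _)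
    (fun _ => 1) (fun _ => rfl)
  · simpa only [one_mul] using this
  · have := h.quot_congr (a + p * (j % p ^ u)) (j / p ^ u) (u + 1)
    have e : a + p * (j % p ^ u) + j / p ^ u * p ^ (u + 1) = a + p * j := by
      conv_rhs => rw [← Nat.mod_add_div j (p ^ u)]
      ring
    rwa [e] at this

end FormalCongruences

/-! ## The image of `R⟨λ, 1/g⟩` in `R[[λ]]` -/

section Image

variable {p : ℕ} [Fact p.Prime]

variable (p) in
/-- The ideal `(p, q - 1)` of `R`. -/
noncomputable def baseIdeal : Ideal (BaseRing p) := Ideal.span {(p : BaseRing p), X}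

theorem map_C_baseIdeal : (baseIdeal p).map (C (R := BaseRing p)) = serIdeal p := by
  rw [baseIdeal, Ideal.map_span, Set.image_pair, serIdeal, qElt_sub_one, map_natCast]

theorem mem_serIdeal_pow (n : ℕ) (f : PowerSeries (BaseRing p)) :
    f ∈ serIdeal p ^ n ↔ ∀ k, coeff k f ∈ baseIdeal p ^ n := by
  rw [← map_C_baseIdeal]
  exact mem_map_C_pow (Submodule.fg_span (Set.toFinite _)) n f

theorem mem_serIdeal (f : PowerSeries (BaseRing p)) :
    f ∈ serIdeal p ↔ ∀ k, coeff k f ∈ baseIdeal p := by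
  simpa only [pow_one] using mem_serIdeal_pow 1 f

theorem locIdeal_eq_map (g : Polynomial (BaseRing p)) :
    locIdeal g = ((baseIdeal p).map Polynomial.C).map
      (algebraMap (Polynomial (BaseRing p)) (Localization.Away g)) := by
  rw [baseIdeal, Ideal.map_span, Set.image_pair, Ideal.map_span, Set.image_pair, locIdeal,
    qElt_sub_one, map_natCast, map_natCast]

variable {g : Polynomial (BaseRing p)} {hg : g.coeff 0 = 1}

theorem locToSeries_algebraMap (P : Polynomial (BaseRing p)) :
    locToSeries g hg (algebraMap _ _ P) = (P : PowerSeries (BaseRing p)) := by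
  rw [locToSeries, IsLocalization.Away.lift_eq, Polynomial.coeToPowerSeries.ringHom_apply]

/-- Clear the denominator: `x * g ^ k` is a polynomial, and membership in `serIdeal p ^ n` is tested
coefficientwise. So `R[λ, 1/g]` carries the topology induced from `R[[λ]]`, which yields both
injectivity and the description of the image as a closure. -/
theorem mem_locIdeal_pow {n : ℕ} {x : Localization.Away g}
    (hx : locToSeries g hg x ∈ serIdeal p ^ n) : x ∈ locIdeal g ^ n := by
  obtain ⟨P, ⟨_, k, rfl⟩, rfl⟩ := IsLocalization.exists_mk'_eq (Submonoid.powers g) x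
  have hP : locToSeries g hg (algebraMap _ _ P) ∈ serIdeal p ^ n := by
    rw [← IsLocalization.mk'_spec (Localization.Away g) P (⟨g ^ k, k, rfl⟩ : Submonoid.powers g), map_mul]
    exact Ideal.mul_mem_right _ _ hx
  rw [IsLocalization.mk'_eq_mul_mk'_one]
  refine Ideal.mul_mem_right _ _ ?_
  rw [locIdeal_eq_map, ← Ideal.map_pow, ← Ideal.map_pow]
  refine Ideal.mem_map_of_mem _ (Ideal.mem_map_C_iff.mpr fun i => ?_)
  rw [locToSeries_algebraMap, mem_serIdeal_pow] at hP
  simpa using hP i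

theorem mk_expand (n : ℕ) (t : CompRing g) :
    Ideal.Quotient.mk (serIdeal p ^ n) (expand g hg t) = expandMod g hg n t :=
  IsAdicComplete.mk_liftRingHom _ _ _ _ _

theorem expand_injective : Function.Injective (expand g hg) := by
  rw [injective_iff_map_eq_zero]
  intro t ht
  refine AdicCompletion.ext_evalₐ fun n => ?_
  obtain ⟨x, hx⟩ := Ideal.Quotient.mk_surjective (AdicCompletion.evalₐ (locIdeal g) n t)
  have h := mk_expand (hg := hg) n t
  rw [ht, map_zero, expandMod, RingHom.comp_apply, RingHom.coe_coe, ← hx, Ideal.quotientMap_mk,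
    eq_comm, Ideal.Quotient.eq_zero_iff_mem] at h
  rw [map_zero, ← hx, Ideal.Quotient.eq_zero_iff_mem]
  exact mem_locIdeal_pow h

/-- The image of `R⟨λ, 1/g⟩` in `R[[λ]]` is the `(p, q - 1)`-adic closure of `R[λ, 1/g]`. -/
theorem mem_range_expand_iff {f : PowerSeries (BaseRing p)} :
    f ∈ (expand g hg).range ↔ ∀ n, ∃ x, f - locToSeries g hg x ∈ serIdeal p ^ n := by
  constructor
  · rintro ⟨t, rfl⟩ n
    obtain ⟨x, hx⟩ := Ideal.Quotient.mk_surjective (AdicCompletion.evalₐ (locIdeal g) n t)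
    refine ⟨x, ?_⟩
    rw [← Ideal.Quotient.eq, mk_expand, expandMod, RingHom.comp_apply, RingHom.coe_coe, ← hx,
      Ideal.quotientMap_mk]
  · intro h
    choose x hx using h
    have hc : ∀ n, x n ≡ x (n + 1) [SMOD (locIdeal g ^ n • ⊤ : Ideal (Localization.Away g))] := by
      intro n
      rw [SModEq.sub_mem, smul_eq_mul, Ideal.mul_top]
      refine mem_locIdeal_pow (hg := hg) ?_
      have h2 := sub_mem (Ideal.pow_le_pow_right (Nat.le_succ n) (hx (n + 1))) (hx n)
      rwa [sub_sub_sub_cancel_left, ← map_sub] at h2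
    refine ⟨AdicCompletion.mk _ _ (AdicCompletion.AdicCauchySequence.mk _ _ x hc), ?_⟩
    refine IsHausdorff.eq_iff_smodEq (I := serIdeal p) |>.mpr fun n => ?_
    rw [smul_eq_mul, Ideal.mul_top, SModEq.sub_mem, ← Ideal.Quotient.eq, mk_expand, expandMod,
      RingHom.comp_apply, RingHom.coe_coe, AdicCompletion.evalₐ_mk, Ideal.quotientMap_mk, eq_comm,
      Ideal.Quotient.eq]
    exact hx n

theorem locToSeries_mem_range (x : Localization.Away g) :
    locToSeries g hg x ∈ (expand g hg).range :=
  ⟨_, expand_of g hg x⟩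

theorem coe_mem_range (P : Polynomial (BaseRing p)) :
    (P : PowerSeries (BaseRing p)) ∈ (expand g hg).range := by
  rw [← locToSeries_algebraMap (g := g) (hg := hg)]
  exact locToSeries_mem_range _

theorem mem_range_of_forall_sub_mem {f : PowerSeries (BaseRing p)}
    (h : ∀ n, ∃ r ∈ (expand g hg).range, f - r ∈ serIdeal p ^ n) : f ∈ (expand g hg).range := by
  rw [mem_range_expand_iff]
  intro n
  obtain ⟨r, hr, hfr⟩ := h n
  obtain ⟨x, hx⟩ := mem_range_expand_iff.mp hr n
  refine ⟨x, ?_⟩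
  have := add_mem hfr hx
  rwa [sub_add_sub_cancel] at this

/-- An element of the image congruent to a power of `g` is invertible in the image. -/
theorem inverse_mem_range {f y : PowerSeries (BaseRing p)} (hf : f ∈ (expand g hg).range)
    (hy : f * y = 1) {e : ℕ} (he : f - (g : PowerSeries (BaseRing p)) ^ e ∈ serIdeal p) :
    y ∈ (expand g hg).range := by
  obtain ⟨G, hG, hgG⟩ : ∃ G ∈ (expand g hg).range, (g : PowerSeries (BaseRing p)) * G = 1 := by
    refine ⟨_, locToSeries_mem_range (IsLocalization.Away.invSelf g), ?_⟩
    rw [← locToSeries_algebraMap (g := g) (hg := hg), ← map_mul,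
      IsLocalization.Away.mul_invSelf, map_one]
  have hgGe : (g : PowerSeries (BaseRing p)) ^ e * G ^ e = 1 := by
    rw [← mul_pow, hgG, one_pow]
  -- `j` measures how far `G ^ e` is from inverting `f`. It lies in `(p, q - 1)`, so `y = G ^ e / (1
  -- - j)` is the limit of geometric sums.
  set j := 1 - f * G ^ e with hj
  have hjJ : j ∈ serIdeal p := by
    have : j = -(f - (g : PowerSeries (BaseRing p)) ^ e) * G ^ e := by
      rw [hj, ← hgGe]
      ring
    rw [this]
    exact Ideal.mul_mem_right _ _ (neg_mem he)
  have hjr : j ∈ (expand g hg).range := sub_mem (one_mem _) (mul_mem hf (pow_mem hG e))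
  refine mem_range_of_forall_sub_mem fun n => ⟨G ^ e * ∑ i ∈ Finset.range n, j ^ i,
    mul_mem (pow_mem hG e) (sum_mem fun i _ => pow_mem hjr i), ?_⟩
  have h : y - G ^ e * ∑ i ∈ Finset.range n, j ^ i = j ^ n * y := by
    have h1 := mul_neg_geom_sum j n
    have h2 : 1 - j = f * G ^ e := by rw [hj]; ring
    rw [h2] at h1
    calc y - G ^ e * ∑ i ∈ Finset.range n, j ^ i
        = y - (f * y) * G ^ e * ∑ i ∈ Finset.range n, j ^ i := by rw [hy, one_mul]
      _ = y - y * (f * G ^ e * ∑ i ∈ Finset.range n, j ^ i) := by ring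
      _ = j ^ n * y := by rw [h1]; ring
  rw [h]
  exact Ideal.mul_mem_right _ _ (Ideal.pow_mem_pow hjJ n)

/-- `g ^ k` is congruent to `g' ^ k`, hence invertible in the image for `g'`. That image then
contains `R[λ, 1/g]`, and being closed it contains the closure too. -/
theorem range_expand_le {g' : Polynomial (BaseRing p)} {hg' : g'.coeff 0 = 1}
    (h : (g : PowerSeries (BaseRing p)) - (g' : PowerSeries (BaseRing p)) ∈ serIdeal p) :
    (expand g hg).range ≤ (expand g' hg').range := by
  intro f hf
  refine mem_range_of_forall_sub_mem fun n => ?_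
  obtain ⟨x, hx⟩ := mem_range_expand_iff.mp hf n
  refine ⟨_, ?_, hx⟩
  obtain ⟨P, ⟨_, k, rfl⟩, rfl⟩ := IsLocalization.exists_mk'_eq (Submonoid.powers g) x
  rw [IsLocalization.mk'_eq_mul_mk'_one, map_mul, locToSeries_algebraMap]
  refine mul_mem (coe_mem_range P) ?_
  refine inverse_mem_range (f := (g : PowerSeries (BaseRing p)) ^ k) (e := k)
    (pow_mem (coe_mem_range g) k) ?_ ?_
  · rw [← Polynomial.coe_pow, ← locToSeries_algebraMap (g := g) (hg := hg) (g ^ k), ← map_mul]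
    have := IsLocalization.mk'_spec' (Localization.Away g) (1 : Polynomial (BaseRing p))
      (⟨g ^ k, k, rfl⟩ : Submonoid.powers g)
    rw [this, map_one, map_one]
  · exact Ideal.mem_of_dvd _ (sub_dvd_pow_sub_pow _ _ k) h

/-- The rings `R⟨λ, 1/g⟩` and `R⟨λ, 1/g'⟩` agree when `g` and `g'` are congruent modulo
`(p, q - 1)`. -/
theorem exists_algEquiv_of_sub_mem {g' : Polynomial (BaseRing p)} {hg' : g'.coeff 0 = 1}
    (h : (g : PowerSeries (BaseRing p)) - (g' : PowerSeries (BaseRing p)) ∈ serIdeal p) :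
    ∃ e : CompRing g ≃ₐ[Polynomial (BaseRing p)] CompRing g',
      ∀ t, expand g' hg' (e t) = expand g hg t := by
  have hr : (expand g hg).range = (expand g' hg').range := by
    refine le_antisymm (range_expand_le h) (range_expand_le ?_)
    rw [← neg_sub]
    exact neg_mem h
  let e₁ : CompRing g ≃+* (expand g hg).range :=
    RingEquiv.ofBijective (expand g hg).rangeRestrict
      ⟨fun a b hab => expand_injective (congrArg Subtype.val hab),
        (expand g hg).rangeRestrict_surjective⟩
  let e₂ : CompRing g' ≃+* (expand g' hg').range :=
    RingEquiv.ofBijective (expand g' hg').rangeRestrict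
      ⟨fun a b hab => expand_injective (congrArg Subtype.val hab),
        (expand g' hg').rangeRestrict_surjective⟩
  let e₃ : CompRing g ≃+* CompRing g' :=
    (e₁.trans (RingEquiv.subringCongr hr)).trans e₂.symm
  have he : ∀ t, expand g' hg' (e₃ t) = expand g hg t := by
    intro t
    have : e₂ (e₃ t) = RingEquiv.subringCongr hr (e₁ t) := e₂.apply_symm_apply _
    exact congrArg Subtype.val this
  refine ⟨AlgEquiv.ofRingEquiv (f := e₃) fun P => ?_, he⟩
  apply expand_injective (hg := hg')
  rw [he, AdicCompletion.algebraMap_apply, AdicCompletion.algebraMap_apply, expand_of, expand_of,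
    locToSeries_algebraMap, locToSeries_algebraMap]

end Image

/-! ## The logarithmic `q`-derivative -/

section LogDerivative

variable {p : ℕ} [Fact p.Prime]

theorem prime_ne_zero (p : ℕ) [hp : Fact p.Prime] : p ≠ 0 := hp.out.ne_zero

theorem qElt_sub_one_ne_zero : (qElt p - 1 : BaseRing p) ≠ 0 := by
  rw [qElt_sub_one]
  exact X_ne_zero

/-! ### Ratios of `q`-numbers and their position relative to `(p, q - 1)` -/

variable (p) in
/-- The element `[p ^ s]_q / [p ^ t]_q` of `R`, for `t ≤ s`. -/
noncomputable def qRatio (s t : ℕ) : BaseRing p :=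
  ∑ i ∈ Finset.range (p ^ (s - t)), (qElt p ^ p ^ t) ^ i

theorem qRatio_zero (s : ℕ) : qRatio p s 0 = qNum ((p ^ s : ℕ) : ℤ_[p]) := by
  rw [qNum_natCast]
  simp [qRatio]

theorem frob_qRatio (s t : ℕ) : frob p (qRatio p s t) = qRatio p (s + 1) (t + 1) := by
  simp only [qRatio, map_sum, map_pow, frob_qElt, Nat.add_sub_add_right]
  refine Finset.sum_congr rfl fun i _ => ?_
  rw [← pow_mul (qElt p) p, pow_succ']

theorem qRatio_mul {s t u : ℕ} (hut : u ≤ t) (hts : t ≤ s) :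
    qRatio p t u * qRatio p s t = qRatio p s u := by
  have h : ∀ {s t : ℕ}, t ≤ s →
      (qElt p ^ p ^ t - 1) * qRatio p s t = qElt p ^ p ^ s - 1 := by
    intro s t hts
    rw [qRatio, mul_geom_sum, ← pow_mul, ← pow_add, Nat.add_sub_cancel' hts]
  have hne : (qElt p ^ p ^ u - 1 : BaseRing p) ≠ 0 := by
    intro h0
    have h2 := mul_qNum ((p ^ u : ℕ) : ℤ_[p])
    rw [binomialSeries_nat, ← qElt, h0] at h2
    have h3 := (mul_eq_zero.mp h2).resolve_left qElt_sub_one_ne_zero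
    have h4 := congrArg (coeff 0) h3
    rw [qNum, coeff_mk, Ring.choose_one_right, map_zero] at h4
    exact pow_ne_zero u (prime_ne_zero p) (Nat.cast_eq_zero.mp h4)
  apply mul_left_cancel₀ hne
  rw [← mul_assoc, h hut, h hts, h (hut.trans hts)]

theorem qRatio_succ_mem (s : ℕ) : qRatio p (s + 1) s ∈ baseIdeal p := by
  have h : ∀ k : ℕ, (qElt p ^ k - 1 : BaseRing p) ∈ baseIdeal p := by
    intro k
    have h1 : (qElt p - 1 : BaseRing p) ∈ baseIdeal p := by
      rw [qElt_sub_one]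
      exact Ideal.subset_span (by simp)
    exact Ideal.mem_of_dvd _ (sub_one_dvd_pow_sub_one _ k) h1
  have e : qRatio p (s + 1) s =
      ∑ i ∈ Finset.range p, ((qElt p ^ p ^ s) ^ i - 1) + (p : BaseRing p) := by
    rw [qRatio, Nat.add_sub_cancel_left, pow_one, Finset.sum_sub_distrib]
    simp
  rw [e]
  refine add_mem (sum_mem fun i _ => ?_) (Ideal.subset_span (by simp))
  rw [← pow_mul]
  exact h _

/-- `[p^s]_q` is a product of `s` ratios `[p^{i+1}]_q / [p^i]_q`, each congruent to `p` modulo `q -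
1`. -/
theorem qRatio_zero_mem_pow (s : ℕ) : qRatio p s 0 ∈ baseIdeal p ^ s := by
  induction s with
  | zero => simp
  | succ s ih =>
    rw [← qRatio_mul (Nat.zero_le s) (Nat.le_succ s), pow_succ]
    exact Ideal.mul_mem_mul ih (qRatio_succ_mem s)

theorem mem_serIdeal_pow_of_dvd {s : ℕ} {f : PowerSeries (BaseRing p)}
    (h : C (qRatio p s 0) ∣ f) : f ∈ serIdeal p ^ s := by
  refine Ideal.mem_of_dvd _ h ?_
  rw [← map_C_baseIdeal, ← Ideal.map_pow]
  exact Ideal.mem_map_of_mem _ (qRatio_zero_mem_pow s)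

/-! ### The Frobenius of `R` and the passage from quotients in `Q` to elements of `R` -/

theorem frob_X : frob p X = qElt p ^ p - 1 := by
  rw [← qElt_sub_one, map_sub, frob_qElt, map_one]

theorem frob_C (a : ℤ_[p]) : frob p (C a) = C a :=
  (frob p).commutes a

theorem constantCoeff_frob (f : BaseRing p) : constantCoeff (frob p f) = constantCoeff f := by
  obtain ⟨g, hg⟩ : X ∣ f - C (constantCoeff f) := by
    rw [X_dvd_iff]
    simp
  have e : f = C (constantCoeff f) + X * g := by rw [← hg]; ring
  rw [e, map_add, map_mul, frob_X, ← e, frob_C]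
  simp [qElt]

/-- Write `f = (q - 1) ^ n * g` with `n` the order of `f`. As `φ(q - 1) = q ^ p - 1` is nonzero,
`φ(f) = 0` gives `φ(g) = 0`. But `φ` preserves constant coefficients, so `g` has constant
coefficient `0`, against the choice of `n`. This makes the denominators `φ(B(n))` nonzero. -/
theorem frob_injective : Function.Injective (frob p) := by
  rw [injective_iff_map_eq_zero]
  intro f hf
  by_contra hne
  obtain ⟨g, hg⟩ := X_pow_order_dvd (φ := f)
  have hX := frob_X (p := p)
  have hXne : frob p X ≠ 0 := by
    intro h0
    have h2 : (qElt p - 1) * qRatio p 1 0 = qElt p ^ p - 1 := by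
      rw [qRatio_zero, pow_one, mul_qNum, binomialSeries_nat, qElt]
    rw [← hX, h0] at h2
    have h3 := (mul_eq_zero.mp h2).resolve_left qElt_sub_one_ne_zero
    have h4 := congrArg (coeff 0) h3
    rw [qRatio_zero, qNum, coeff_mk, Ring.choose_one_right, map_zero, pow_one] at h4
    exact prime_ne_zero p (Nat.cast_eq_zero.mp h4)
  rw [hg, map_mul, map_pow] at hf
  have hg0 := (mul_eq_zero.mp hf).resolve_left (pow_ne_zero _ hXne)
  have h0 : constantCoeff g = 0 := by rw [← constantCoeff_frob, hg0, map_zero]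
  obtain ⟨g', rfl⟩ := X_dvd_iff.mpr h0
  have hdvd : X ^ (f.order.toNat + 1) ∣ f := ⟨g', by rw [pow_succ, mul_assoc]; exact hg⟩
  have := X_pow_dvd_iff.mp hdvd f.order.toNat (Nat.lt_succ_self _)
  exact coeff_order hne this

theorem DworkConditions.exists_frobContinuous {B : ℕ → BaseRing p} (hB : DworkConditions B) :
    ∃ c, FrobContinuous (frob p : BaseRing p →+* BaseRing p) p (qRatio p) c B := by
  choose c hc using hB.integral
  have hinj : Function.Injective (algebraMap (BaseRing p) (QuotField p)) :=
    IsFractionRing.injective _ _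
  have hne : ∀ n, algebraMap (BaseRing p) (QuotField p) (frob p (B n)) ≠ 0 := by
    intro n h0
    refine hB.ne_zero n (frob_injective (hinj ?_))
    rw [h0, map_zero, map_zero]
  refine ⟨c, frob_qRatio, fun s t h => qRatio_mul (Nat.zero_le t) h, fun n => hinj ?_, ?_,
    hB.zero_eq_one⟩
  · rw [map_mul, ← hc, frobQuot, RingHom.coe_coe, div_mul_cancel₀ _ (hne _)]
  · intro n m s
    cases s with
    -- The modulus `qRatio p 0 0` is `1`; the hypothesis `congr` only starts at exponent `1`.
    | zero => simp [qRatio]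
    | succ s =>
      obtain ⟨d, hd⟩ := hB.congr n m s
      have e : n / p + m * p ^ s = (n + m * p ^ (s + 1)) / p := by
        rw [pow_succ, ← mul_assoc, Nat.add_mul_div_right _ _ (Nat.pos_of_ne_zero (prime_ne_zero p))]
      rw [e, hc, hc, ← map_sub] at hd
      exact ⟨d, by rw [qRatio_zero]; exact hinj hd⟩

/-! ### Rules for `d_q`, `γ` and the Frobenius of `R[[λ]]` -/

theorem C_mul_X_ne_zero : (C (qElt p - 1) * X : PowerSeries (BaseRing p)) ≠ 0 := by
  refine mul_ne_zero ?_ X_ne_zero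
  rw [Ne, ← map_zero C, C_injective.eq_iff]
  exact qElt_sub_one_ne_zero

theorem qDeriv_mul (f g : PowerSeries (BaseRing p)) :
    qDeriv (f * g) = qDeriv f * g + gam f * qDeriv g := by
  apply mul_left_cancel₀ (C_mul_X_ne_zero (p := p))
  rw [mul_qDeriv, mul_add, ← mul_assoc, mul_qDeriv, mul_left_comm, mul_qDeriv, map_mul]
  ring

theorem qDeriv_add (f g : PowerSeries (BaseRing p)) :
    qDeriv (f + g) = qDeriv f + qDeriv g := by
  apply mul_left_cancel₀ (C_mul_X_ne_zero (p := p))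
  rw [mul_add, mul_qDeriv, mul_qDeriv, mul_qDeriv, map_add]
  ring

theorem gam_C (a : BaseRing p) : gam (C a) = C a := by
  ext1 n
  rw [gam, coeff_rescale, coeff_C]
  split_ifs with h
  · rw [h, pow_zero, one_mul]
  · rw [mul_zero]

theorem qDeriv_C_mul (a : BaseRing p) (f : PowerSeries (BaseRing p)) :
    qDeriv (C a * f) = C a * qDeriv f := by
  apply mul_left_cancel₀ (C_mul_X_ne_zero (p := p))
  rw [mul_qDeriv, mul_left_comm, mul_qDeriv, map_mul, gam_C]
  ring

variable (p) in
/-- The Frobenius endomorphism of `R[[λ]]`. -/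
noncomputable abbrev frobSeries : PowerSeries (BaseRing p) →+* PowerSeries (BaseRing p) :=
  serFrob (frob p : BaseRing p →+* BaseRing p) p (prime_ne_zero p)

theorem frobSeries_C (a : BaseRing p) : frobSeries p (C a) = C (frob p a) := by
  simp [frobSeries, serFrob, PowerSeries.expand_C]

theorem frobSeries_X : frobSeries p X = X ^ p := by
  simp [frobSeries, serFrob]

theorem coeff_frobSeries (f : PowerSeries (BaseRing p)) (n : ℕ) :
    coeff n (frobSeries p f) = if p ∣ n then frob p (coeff (n / p) f) else 0 := by
  simp [frobSeries, serFrob, coeff_expand]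

theorem gam_frobSeries (f : PowerSeries (BaseRing p)) :
    gam (frobSeries p f) = frobSeries p (gam f) := by
  ext1 n
  rw [gam, coeff_rescale, coeff_frobSeries, coeff_frobSeries]
  split_ifs with h
  · rw [coeff_rescale, map_mul, map_pow, frob_qElt, ← pow_mul, Nat.mul_div_cancel' h]
  · rw [mul_zero]

/-- Apply the Frobenius to `(q - 1) λ d_q f = γ(f) - f`: it commutes with `γ` and multiplies `(q -
1) λ` by `[p]_q λ^{p-1}`. Each Frobenius step thus gains a factor `[p]_q`. -/
theorem qDeriv_frobSeries (f : PowerSeries (BaseRing p)) :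
    qDeriv (frobSeries p f) = C (qRatio p 1 0) * (X ^ (p - 1) * frobSeries p (qDeriv f)) := by
  apply mul_left_cancel₀ (C_mul_X_ne_zero (p := p))
  have h := congrArg (frobSeries p) (mul_qDeriv f)
  rw [map_mul, map_mul, frobSeries_C, frobSeries_X, map_sub (frobSeries p), map_sub (frob p),
    frob_qElt, map_one, ← gam_frobSeries, ← mul_qDeriv] at h
  rw [← h, qRatio_zero, pow_one]
  have h2 : (qElt p ^ p - 1 : BaseRing p) = (qElt p - 1) * qNum (p : ℤ_[p]) := by
    rw [mul_qNum, binomialSeries_nat, qElt]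
  have h3 : (X : PowerSeries (BaseRing p)) ^ p = X * X ^ (p - 1) := by
    rw [← pow_succ', Nat.sub_add_cancel (Nat.pos_of_ne_zero (prime_ne_zero p))]
  rw [h2, h3, map_mul]
  ring

theorem isUnit_of_coeff_zero {f : PowerSeries (BaseRing p)} (h : coeff 0 f = 1) : IsUnit f := by
  rw [PowerSeries.isUnit_iff_constantCoeff, ← coeff_zero_eq_constantCoeff_apply, h]
  exact isUnit_one

theorem coeff_zero_trunc {B : ℕ → BaseRing p} (h0 : B 0 = 1) (s : ℕ) :
    coeff 0 ((trunc (p ^ s) (mk B) : Polynomial (BaseRing p)) : PowerSeries (BaseRing p)) = 1 := by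
  rw [coe_trunc_eq_mk, coeff_mk, if_pos (pow_pos (Nat.pos_of_ne_zero (prime_ne_zero p)) s), h0]

theorem coe_trunc_one {B : ℕ → BaseRing p} (h0 : B 0 = 1) :
    ((trunc (p ^ 0) (mk B) : Polynomial (BaseRing p)) : PowerSeries (BaseRing p)) = 1 := by
  rw [coe_trunc_eq_mk]
  ext1 n
  rw [coeff_mk, coeff_one, pow_zero]
  rcases Nat.eq_zero_or_pos n with rfl | hn
  · simp [h0]
  · rw [if_neg (by omega), if_neg (by omega)]

variable {B c : ℕ → BaseRing p}

/-- The quotient of `F` by its truncation at degree `p ^ s` has `q`-derivative divisible by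
`[p ^ s]_q`. -/
theorem exists_eq_mul_trunc
    (h : FrobContinuous (frob p : BaseRing p →+* BaseRing p) p (qRatio p) c B) (s : ℕ) :
    ∃ H, mk B = H * (trunc (p ^ s) (mk B) : Polynomial (BaseRing p)) ∧
      C (qRatio p s 0) ∣ qDeriv H := by
  induction s with
  | zero =>
    refine ⟨mk B, ?_, ?_⟩
    · rw [coe_trunc_one h.zero_eq_one, mul_one]
    · have : qRatio p 0 0 = 1 := by simp [qRatio]
      rw [this, map_one]
      exact one_dvd _
  | succ s ih =>
    obtain ⟨H, hH, hdH⟩ := ih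
    obtain ⟨w, hw⟩ := formal_congruence h (prime_ne_zero p) s
    obtain ⟨u, hu⟩ := isUnit_serFrob_trunc (frob p : BaseRing p →+* BaseRing p) (prime_ne_zero p)
      h.zero_eq_one (pow_pos (Nat.pos_of_ne_zero (prime_ne_zero p)) s : 0 < p ^ s)
    obtain ⟨v, hv⟩ := isUnit_of_coeff_zero (coeff_zero_trunc h.zero_eq_one (s + 1))
    have hφ := congrArg (frobSeries p) hH
    rw [map_mul] at hφ
    change frobSeries p (mk B) = _ at hφ
    change ↑u = frobSeries p _ at hu
    change mk B * frobSeries p _ - frobSeries p (mk B) * _ = _ at hw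
    rw [hφ, ← hu, ← hv] at hw
    -- With `u = φ(F_s)` and `v = F_{s+1}`, this is the formal congruence divided by `u * v`, using
    -- `φ(F) = φ(H) u`.
    refine ⟨frobSeries p H + C (qRatio p (s + 1) 0) * (w * ↑u⁻¹ * ↑v⁻¹), ?_, ?_⟩
    · rw [← hv]
      calc mk B = (mk B * u - frobSeries p H * u * v) * ↑u⁻¹ + frobSeries p H * v := by
            rw [sub_mul, mul_assoc (mk B), Units.mul_inv, mul_assoc (frobSeries p H),
              mul_comm (u : PowerSeries (BaseRing p)) v, ← mul_assoc, mul_assoc _ _ (↑u⁻¹ : PowerSeries (BaseRing p)),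
              Units.mul_inv]
            ring
        _ = C (qRatio p (s + 1) 0) * w * ↑u⁻¹ + frobSeries p H * v := by rw [hw]
        _ = C (qRatio p (s + 1) 0) * w * ↑u⁻¹ * (↑v⁻¹ * v) + frobSeries p H * v := by
            rw [Units.inv_mul, mul_one]
        _ = _ := by ring
    · rw [qDeriv_add, qDeriv_C_mul, qDeriv_frobSeries]
      refine dvd_add ?_ (dvd_mul_right _ _)
      -- `[p^{s+1}]_q = [p]_q φ([p^s]_q)`: the first factor comes from `qDeriv_frobSeries`, the
      -- second from the induction hypothesis.
      rw [← qRatio_mul (Nat.zero_le 1) (Nat.le_add_left 1 s), map_mul]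
      refine mul_dvd_mul_left _ (Dvd.dvd.mul_left ?_ _)
      have := map_dvd (frobSeries p) hdH
      rwa [frobSeries_C, frob_qRatio] at this

/-! ### Reduction modulo `(p, q - 1)` -/

variable (p) in
/-- The reduction `R → 𝔽_p` modulo `(p, q - 1)`. -/
noncomputable def residue : BaseRing p →+* ZMod p :=
  PadicInt.toZMod.comp constantCoeff

theorem mem_baseIdeal_iff (r : BaseRing p) : r ∈ baseIdeal p ↔ residue p r = 0 := by
  constructor
  · intro h
    have : baseIdeal p ≤ RingHom.ker (residue p) := by
      rw [baseIdeal, Ideal.span_le]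
      rintro x (rfl | rfl)
      · simp [RingHom.mem_ker]
      · simp [RingHom.mem_ker, residue]
    exact this h
  · intro h
    have h1 : constantCoeff r ∈ RingHom.ker (PadicInt.toZMod (p := p)) := h
    rw [PadicInt.ker_toZMod, PadicInt.maximalIdeal_eq_span_p, Ideal.mem_span_singleton] at h1
    obtain ⟨a, ha⟩ := h1
    obtain ⟨g', hg'⟩ : X ∣ r - C (constantCoeff r) := by
      rw [X_dvd_iff]
      simp
    have e : r = (p : BaseRing p) * C a + X * g' := by
      rw [← hg', ha, map_mul, map_natCast]
      ring
    rw [e]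
    exact add_mem (Ideal.mul_mem_right _ _ (Ideal.subset_span (by simp)))
      (Ideal.mul_mem_right _ _ (Ideal.subset_span (by simp)))

theorem residue_frob (r : BaseRing p) : residue p (frob p r) = residue p r := by
  rw [residue, RingHom.comp_apply, constantCoeff_frob, RingHom.comp_apply]

theorem mem_serIdeal_iff (f : PowerSeries (BaseRing p)) :
    f ∈ serIdeal p ↔ PowerSeries.map (residue p) f = 0 := by
  rw [mem_serIdeal, PowerSeries.ext_iff]
  simp [mem_baseIdeal_iff]

/-- `φ` induces the identity on the residue field `𝔽_p`, over which `f(λ ^ p) = f(λ) ^ p`. -/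
theorem frobSeries_sub_pow_mem (f : PowerSeries (BaseRing p)) :
    frobSeries p f - f ^ p ∈ serIdeal p := by
  rw [mem_serIdeal_iff, map_sub, map_pow, sub_eq_zero]
  have h := MvPowerSeries.map_frobenius_expand p (prime_ne_zero p)
    (f := PowerSeries.map (residue p) f)
  rw [ZMod.frobenius_zmod] at h
  rw [← show _ = PowerSeries.map (residue p) f ^ p from h]
  ext1 n
  have h2 : ∀ k : PowerSeries (ZMod p), MvPowerSeries.map (RingHom.id (ZMod p)) k = k := by
    intro k
    rw [MvPowerSeries.map_id, RingHom.id_apply]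
  rw [h2, coeff_map, coeff_frobSeries]
  change _ = coeff n (PowerSeries.expand p (prime_ne_zero p) (PowerSeries.map (residue p) f))
  rw [coeff_expand]
  split_ifs with hd
  · rw [residue_frob, coeff_map]
  · rw [map_zero]

/-- The truncations of `F` at degrees `p ^ s` are congruent to powers of `F_1`. -/
theorem exists_trunc_sub_pow_mem
    (h : FrobContinuous (frob p : BaseRing p →+* BaseRing p) p (qRatio p) c B) (s : ℕ) :
    ∃ e, ((trunc (p ^ s) (mk B) : Polynomial (BaseRing p)) : PowerSeries (BaseRing p)) -
      ((trunc p (mk B) : Polynomial (BaseRing p)) : PowerSeries (BaseRing p)) ^ e ∈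
        serIdeal p := by
  have h0 := coe_trunc_one h.zero_eq_one
  induction s with
  | zero =>
    refine ⟨0, ?_⟩
    rw [h0, pow_zero, sub_self]
    exact zero_mem _
  | succ s ih =>
    obtain ⟨e, he⟩ := ih
    -- Modulo `(p, q - 1)`, the congruence at level `0` reads `F ≡ φ(F) F_1`, because `F_0 = 1`.
    -- Comparison with level `s` gives `F_{s+1} ≡ F_1 φ(F_s) ≡ F_1 F_s ^ p`.
    refine ⟨e * p + 1, ?_⟩
    have h1 := formal_congruence h (prime_ne_zero p) s
    have h2 := formal_congruence h (prime_ne_zero p) 0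
    rw [h0, map_one, mul_one, zero_add, pow_one] at h2
    obtain ⟨u, hu⟩ : IsUnit (frobSeries p (mk B)) :=
      (isUnit_of_coeff_zero (by rw [coeff_mk, h.zero_eq_one])).map _
    change C _ ∣ mk B * frobSeries p _ - frobSeries p (mk B) * _ at h1
    change C _ ∣ mk B - frobSeries p (mk B) * _ at h2
    rw [← hu] at h1 h2
    have h1' : mk B * frobSeries p (trunc (p ^ s) (mk B) : Polynomial (BaseRing p)) -
        u * (trunc (p ^ (s + 1)) (mk B) : Polynomial (BaseRing p)) ∈ serIdeal p :=
      Ideal.pow_le_self (Nat.succ_ne_zero s) (mem_serIdeal_pow_of_dvd h1)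
    have h2' := mem_serIdeal_pow_of_dvd h2
    rw [pow_one] at h2'
    have h3 := Ideal.mem_of_dvd _ (sub_dvd_pow_sub_pow _ _ p) he
    have h4 := frobSeries_sub_pow_mem
      (trunc (p ^ s) (mk B) : Polynomial (BaseRing p)).toPowerSeries
    have h5 := add_mem h4 h3
    rw [sub_add_sub_cancel] at h5
    rw [← Ideal.unit_mul_mem_iff_mem _ u.isUnit]
    have key : ∀ F U T1 S E S' : PowerSeries (BaseRing p), U * (S' - T1 * E) =
        -(F * S - U * S') + (F - U * T1) * S + U * T1 * (S - E) := by
      intros; ring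
    rw [pow_succ' _ (e * p), pow_mul, key (mk B) _ _
      (frobSeries p (trunc (p ^ s) (mk B) : Polynomial (BaseRing p)))]
    exact add_mem (add_mem (neg_mem h1') (Ideal.mul_mem_right _ _ h2'))
      (Ideal.mul_mem_left _ _ h5)

theorem gam_sub_mem (f : PowerSeries (BaseRing p)) : gam f - f ∈ serIdeal p := by
  rw [← mul_qDeriv, mul_assoc]
  exact Ideal.mul_mem_right _ _ (Ideal.subset_span (by simp))

variable {g : Polynomial (BaseRing p)} {hg : g.coeff 0 = 1}

theorem mem_range_of_coeff_eq_zero {f : PowerSeries (BaseRing p)} {N : ℕ}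
    (h : ∀ k, N ≤ k → coeff k f = 0) : f ∈ (expand g hg).range := by
  have : f = (trunc N f : Polynomial (BaseRing p)) := by
    ext1 k
    rw [Polynomial.coeff_coe, coeff_trunc]
    split_ifs with hk
    · rfl
    · exact h k (by omega)
  rw [this]
  exact coe_mem_range _

theorem coeff_zero_gam (f : PowerSeries (BaseRing p)) : coeff 0 (gam f) = coeff 0 f := by
  rw [gam, coeff_rescale, pow_zero, one_mul]

theorem mul_invOfUnit_one {f : PowerSeries (BaseRing p)} (h : coeff 0 f = 1) :
    f * invOfUnit f 1 = 1 := by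
  refine mul_invOfUnit f 1 ?_
  rw [← coeff_zero_eq_constantCoeff_apply, h, Units.val_one]

/-- The approximants are `d_q F_s / F_s` and `d_q F_s / γ(F_s)`. With `F = H F_s`, the errors are
`d_q H` times `γ(F_s) / F` and `F_s / γ(F)` respectively. -/
theorem qDeriv_mul_inv_mem_range
    (h : FrobContinuous (frob p : BaseRing p →+* BaseRing p) p (qRatio p) c B)
    (hg : (trunc p (mk B)).coeff 0 = 1) :
    qDeriv (mk B) * invOfUnit (mk B) 1 ∈ (expand (trunc p (mk B)) hg).range ∧
      qDeriv (mk B) * invOfUnit (gam (mk B)) 1 ∈ (expand (trunc p (mk B)) hg).range := by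
  have hB : coeff 0 (mk B) = 1 := by rw [coeff_mk, h.zero_eq_one]
  have hFi := mul_invOfUnit_one hB
  have hgFi := mul_invOfUnit_one ((coeff_zero_gam _).trans hB)
  have hd : ∀ s, qDeriv ((trunc (p ^ s) (mk B) : Polynomial (BaseRing p)) :
      PowerSeries (BaseRing p)) ∈ (expand (trunc p (mk B)) hg).range := by
    intro s
    refine mem_range_of_coeff_eq_zero (N := p ^ s) fun k hk => ?_
    rw [qDeriv, coeff_mk, coe_trunc_eq_mk, coeff_mk, if_neg (by omega), mul_zero]
  have key : ∀ F Fi G Gi D E : PowerSeries (BaseRing p), F * Fi = 1 → G * Gi = 1 →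
      D * Fi - E * Gi = (D * G - E * F) * (Fi * Gi) := by
    intro F Fi G Gi D E h1 h2
    calc D * Fi - E * Gi = D * Fi * (G * Gi) - E * Gi * (F * Fi) := by rw [h1, h2]; ring
      _ = _ := by ring
  constructor
  · refine mem_range_of_forall_sub_mem fun s => ?_
    obtain ⟨H, hH, hdH⟩ := exists_eq_mul_trunc h s
    obtain ⟨e, he⟩ := exists_trunc_sub_pow_mem h s
    have hi := mul_invOfUnit_one (coeff_zero_trunc h.zero_eq_one s)
    refine ⟨_, mul_mem (hd s) (inverse_mem_range (coe_mem_range _) hi he),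
      mem_serIdeal_pow_of_dvd ?_⟩
    rw [key _ _ _ _ _ _ hFi hi]
    refine Dvd.dvd.mul_right ?_ _
    generalize ((trunc (p ^ s) (mk B) : Polynomial (BaseRing p)) : PowerSeries (BaseRing p)) = S
      at hH
    -- The twisted Leibniz rule is not symmetric: in this order `γ` falls on `S`, and the terms with
    -- `qDeriv S` cancel. The other quotient needs the opposite order.
    rw [hH, mul_comm H S, qDeriv_mul]
    have e1 : (qDeriv S * H + gam S * qDeriv H) * S - qDeriv S * (S * H) =
        qDeriv H * (gam S * S) := by ring
    rw [e1]
    exact hdH.mul_right _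
  · refine mem_range_of_forall_sub_mem fun s => ?_
    obtain ⟨H, hH, hdH⟩ := exists_eq_mul_trunc h s
    obtain ⟨e, he⟩ := exists_trunc_sub_pow_mem h s
    have hi := mul_invOfUnit_one ((coeff_zero_gam _).trans (coeff_zero_trunc h.zero_eq_one s))
    have hgr : gam ((trunc (p ^ s) (mk B) : Polynomial (BaseRing p)) :
        PowerSeries (BaseRing p)) ∈ (expand (trunc p (mk B)) hg).range := by
      refine mem_range_of_coeff_eq_zero (N := p ^ s) fun k hk => ?_
      rw [gam, coeff_rescale, coe_trunc_eq_mk, coeff_mk, if_neg (by omega), mul_zero]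
    -- `γ` is the identity modulo `q - 1`, so `γ(F_s)` is congruent to the same power of `F_1`.
    have he' := add_mem (gam_sub_mem ((trunc (p ^ s) (mk B) : Polynomial (BaseRing p)) :
      PowerSeries (BaseRing p))) he
    rw [sub_add_sub_cancel] at he'
    refine ⟨_, mul_mem (hd s) (inverse_mem_range hgr hi he'), mem_serIdeal_pow_of_dvd ?_⟩
    rw [key _ _ _ _ _ _ hgFi hi]
    refine Dvd.dvd.mul_right ?_ _
    generalize ((trunc (p ^ s) (mk B) : Polynomial (BaseRing p)) : PowerSeries (BaseRing p)) = S
      at hH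
    rw [hH, qDeriv_mul, map_mul]
    have e1 : (qDeriv H * S + gam H * qDeriv S) * gam S - qDeriv S * (gam H * gam S) =
        qDeriv H * (S * gam S) := by ring
    rw [e1]
    exact hdH.mul_right _

end LogDerivative

/-! ## The `q`-hypergeometric series -/

section Hypergeometric

/-- A case of the `q`-Vandermonde identity, for coefficients
`∏_{i < n} (1 - s q ^ i) / (1 - q ^ (i + 1))` with `s ^ 2 = q`. -/
theorem sum_range_mul_pow_eq_one {K : Type*} [Field K] {q s : K} (hs : s ^ 2 = q)
    (hq : ∀ n : ℕ, q ^ (n + 1) ≠ 1) {β : ℕ → K} (h0 : β 0 = 1)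
    (hβ : ∀ n, β (n + 1) * (q ^ (n + 1) - 1) = β n * (s * q ^ n - 1)) (n : ℕ) :
    ∑ i ∈ Finset.range (n + 1), β i * (s ^ (n - i) * β (n - i)) = 1 := by
  set f : PowerSeries K := mk β with hf
  -- The recursion `hβ` as a functional equation: `(1 - λ) f(λ) = (1 - s λ) f(q λ)`.
  have h1 : (1 - X) * f = (1 - C s * X) * rescale q f := by
    ext n
    rw [sub_mul, sub_mul, one_mul, one_mul, mul_assoc, map_sub, map_sub, coeff_C_mul]
    cases n with
    | zero => simp [coeff_rescale]
    | succ n =>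
      simp only [coeff_succ_X_mul, coeff_rescale, hf, coeff_mk]
      linear_combination -hβ n
  have h2 : (1 - C s * X) * rescale s f = (1 - C q * X) * rescale q (rescale s f) := by
    have := congrArg (rescale s) h1
    simp only [map_mul, map_sub, map_one, rescale_X] at this
    have hC : rescale s (C s) = C s := by
      ext n
      rw [coeff_rescale, coeff_C]
      split_ifs with h <;> simp [h]
    rw [hC, ← mul_assoc, ← map_mul, ← sq, hs] at this
    rw [this, rescale_rescale, rescale_rescale, mul_comm s q]
  -- Combining the equation at `λ` and at `s λ` makes this product invariant under `λ ↦ q λ`. Since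
  -- no positive power of `q` is `1`, it is constant, whence `f(λ) f(s λ) = 1 / (1 - λ)`.
  have h3 : (1 - X) * (f * rescale s f) = rescale q ((1 - X) * (f * rescale s f)) := by
    rw [map_mul, map_mul, map_sub, map_one, rescale_X]
    calc (1 - X) * (f * rescale s f) = (1 - X) * f * rescale s f := by ring
      _ = rescale q f * ((1 - C s * X) * rescale s f) := by rw [h1]; ring
      _ = _ := by rw [h2]; ring
  have h4 : (1 - X) * (f * rescale s f) = 1 := by
    ext n
    cases n with
    | zero =>
      rw [sub_mul, one_mul, map_sub, coeff_zero_X_mul, coeff_mul]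
      simp [hf, h0, coeff_rescale, -coeff_zero_eq_constantCoeff]
    | succ n =>
      have := congrArg (coeff (n + 1)) h3
      rw [coeff_rescale] at this
      have h5 : (q ^ (n + 1) - 1) * coeff (n + 1) ((1 - X) * (f * rescale s f)) = 0 := by
        rw [sub_mul, one_mul, ← this, sub_self]
      rw [(mul_eq_zero.mp h5).resolve_left (sub_ne_zero.mpr (hq n)), coeff_one,
        if_neg (Nat.succ_ne_zero n)]
  have h5 : f * rescale s f = mk 1 := by
    have h6 := mk_one_mul_one_sub_eq_one K
    calc f * rescale s f = mk 1 * (1 - X) * (f * rescale s f) := by rw [h6, one_mul]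
      _ = mk 1 * ((1 - X) * (f * rescale s f)) := by ring
      _ = mk 1 := by rw [h4, mul_one]
  have h6 := congrArg (coeff n) h5
  rw [coeff_mul, coeff_mk, Finset.Nat.sum_antidiagonal_eq_sum_range_succ_mk] at h6
  simpa [hf, coeff_rescale] using h6

variable {p : ℕ} [Fact p.Prime]

theorem residue_qNum (a : ℤ_[p]) : residue p (qNum a) = PadicInt.toZMod a := by
  rw [residue, RingHom.comp_apply, ← coeff_zero_eq_constantCoeff_apply, qNum, coeff_mk,
    Ring.choose_one_right]

theorem qNum_natCast_succ_ne_zero (n : ℕ) : (qNum ((n : ℤ_[p]) + 1)) ≠ 0 := by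
  intro h
  have h4 := congrArg (coeff 0) h
  rw [qNum, coeff_mk, Ring.choose_one_right, map_zero] at h4
  exact Nat.cast_add_one_ne_zero n h4

/-- The square root of the coefficient `a_n` of the `q`-hypergeometric series. -/
theorem exists_algebraMap_eq_prod (hp : Odd p) (n : ℕ) :
    ∃ b : BaseRing p, algebraMap (BaseRing p) (QuotField p) b = ∏ i ∈ Finset.range n,
      algebraMap (BaseRing p) (QuotField p) (qNum ((i : ℤ_[p]) + half p)) /
        algebraMap (BaseRing p) (QuotField p) (qNum ((i : ℤ_[p]) + 1)) := by
  set ι := algebraMap (BaseRing p) (QuotField p) with hι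
  have hinj : Function.Injective ι := IsFractionRing.injective _ _
  set β : ℕ → QuotField p := fun n => ∏ i ∈ Finset.range n,
    ι (qNum ((i : ℤ_[p]) + half p)) / ι (qNum ((i : ℤ_[p]) + 1)) with hβ
  set s : BaseRing p := binomialSeries ℤ_[p] (half p) with hs
  have hne : ∀ n : ℕ, ι (qNum ((n : ℤ_[p]) + 1)) ≠ 0 := fun n h =>
    qNum_natCast_succ_ne_zero n (hinj (h.trans (map_zero ι).symm))
  have hs2 : s ^ 2 = qElt p := by
    have h := binomialSeries_nat (R := ℤ_[p]) (A := ℤ_[p]) 1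
    rw [Nat.cast_one, ← two_mul_half p hp, two_mul, binomialSeries_add, ← sq, pow_one] at h
    exact h
  have hnum : ∀ n : ℕ, (qElt p - 1) * qNum ((n : ℤ_[p]) + half p) = s * qElt p ^ n - 1 := by
    intro n
    rw [mul_qNum, binomialSeries_add, binomialSeries_nat, ← qElt, mul_comm]
  have hden : ∀ n : ℕ, (qElt p - 1) * qNum ((n : ℤ_[p]) + 1) = qElt p ^ (n + 1) - 1 := by
    intro n
    rw [mul_qNum, ← Nat.cast_succ, binomialSeries_nat, ← qElt]
  have hq : ∀ n : ℕ, ι (qElt p) ^ (n + 1) ≠ 1 := by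
    intro n h
    have h1 : qElt p ^ (n + 1) = 1 := hinj (by rw [map_pow, h, map_one])
    have h2 := hden n
    rw [h1, sub_self] at h2
    exact qNum_natCast_succ_ne_zero n ((mul_eq_zero.mp h2).resolve_left qElt_sub_one_ne_zero)
  have hrec : ∀ n, β (n + 1) * (ι (qElt p) ^ (n + 1) - 1) =
      β n * (ι s * ι (qElt p) ^ n - 1) := by
    intro n
    have h1 := congrArg ι (hnum n)
    have h2 := congrArg ι (hden n)
    rw [map_mul, map_sub ι (_ * _), map_mul, map_pow, map_one] at h1
    rw [map_mul, map_sub ι (_ ^ _), map_pow, map_one] at h2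
    rw [← h1, ← h2]
    simp only [hβ, Finset.prod_range_succ]
    field_simp [hne n]
  have hsum := sum_range_mul_pow_eq_one (K := QuotField p) (q := ι (qElt p)) (s := ι s)
    (by rw [← map_pow, hs2]) hq (β := β) (by simp [hβ]) hrec
  induction n using Nat.strong_induction_on with
  | _ n ih =>
    rcases Nat.eq_zero_or_pos n with rfl | hn
    · exact ⟨1, by simp⟩
    -- In the identity `hsum n` the two extreme terms add up to `(1 + s ^ n) * β n`, and the others
    -- involve only smaller indices. The constant coefficient of `1 + s ^ n` is `2`, a unit for odd
    -- `p`.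
    obtain ⟨u, hu⟩ : IsUnit (1 + s ^ n) := by
      rw [PowerSeries.isUnit_iff_constantCoeff, map_add, map_one, map_pow, hs,
        binomialSeries_constantCoeff, one_pow, one_add_one_eq_two]
      exact IsUnit.of_mul_eq_one _ (two_mul_half p hp)
    have hmem : ∀ i < n, β i ∈ ι.range := ih
    have h := hsum n
    obtain ⟨m, rfl⟩ : ∃ m, n = m + 1 := ⟨n - 1, by omega⟩
    rw [Finset.sum_range_succ, Finset.sum_range_succ', Nat.sub_self, Nat.sub_zero,
      show β 0 = 1 by simp [hβ]] at h
    have h' : ι u * β (m + 1) =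
        1 - ∑ i ∈ Finset.range m, β (i + 1) * (ι s ^ (m + 1 - (i + 1)) * β (m + 1 - (i + 1))) := by
      rw [hu, map_add, map_one, map_pow]
      linear_combination h
    have hmem' : ι u * β (m + 1) ∈ ι.range := by
      rw [h']
      refine sub_mem (one_mem _) (sum_mem fun i hi => ?_)
      have := Finset.mem_range.mp hi
      exact mul_mem (hmem _ (by omega)) (mul_mem (pow_mem (RingHom.mem_range_self ι s) _) (hmem _ (by omega)))
    have hmem'' : β (m + 1) = ι ↑u⁻¹ * (ι u * β (m + 1)) := by
      rw [← mul_assoc, ← map_mul, Units.inv_mul, map_one, one_mul]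
    have : β (m + 1) ∈ ι.range := by
      rw [hmem'']
      exact mul_mem (RingHom.mem_range_self ι _) hmem'
    exact this

/-- Modulo `p`, `1/2` is `-(p - 1) / 2`, so `hb` reduces to the recursion of the signed binomial
coefficients. The bound `n < p` keeps its divisors nonzero. -/
theorem residue_eq_neg_one_pow_mul_choose (hp : Odd p) {b : ℕ → BaseRing p} (h0 : b 0 = 1)
    (hb : ∀ n : ℕ, b (n + 1) * qNum ((n : ℤ_[p]) + 1) = b n * qNum ((n : ℤ_[p]) + half p))
    (n : ℕ) (hn : n < p) :
    residue p (b n) = (-1) ^ n * (((p - 1) / 2).choose n : ZMod p) := by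
  have hhalf : PadicInt.toZMod (half p) = -(((p - 1) / 2 : ℕ) : ZMod p) := by
    have h2 : (2 : ZMod p) * PadicInt.toZMod (half p) = 1 := by
      have := congrArg PadicInt.toZMod (two_mul_half p hp)
      rwa [map_mul, map_ofNat, map_one] at this
    obtain ⟨k, hk⟩ := hp
    have hk2 : (p - 1) / 2 = k := by omega
    have hpk : (2 : ZMod p) * k + 1 = 0 := by
      have := ZMod.natCast_self p
      rw [congrArg (Nat.cast (R := ZMod p)) hk] at this
      exact_mod_cast this
    rw [hk2]
    linear_combination (-(k : ZMod p)) * h2 + PadicInt.toZMod (half p) * hpk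
  induction n with
  | zero => simp [h0]
  | succ n ih =>
    have ih := ih (by omega)
    have h := congrArg (residue p) (hb n)
    rw [map_mul, map_mul, residue_qNum, residue_qNum, map_add, map_add, map_natCast, map_one, hhalf,
      ih] at h
    have hne : (n : ZMod p) + 1 ≠ 0 := by
      intro h1
      have h2 : ((n + 1 : ℕ) : ZMod p) = 0 := by exact_mod_cast h1
      rw [ZMod.natCast_eq_zero_iff] at h2
      exact absurd (Nat.le_of_dvd (Nat.succ_pos n) h2) (by omega)
    have hch : ((((p - 1) / 2).choose (n + 1) : ℕ) : ZMod p) * (n + 1) =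
        (((p - 1) / 2).choose n : ZMod p) * ((((p - 1) / 2 : ℕ) : ZMod p) - n) := by
      rcases le_or_gt n ((p - 1) / 2) with hle | hlt
      · have := Nat.choose_succ_right_eq ((p - 1) / 2) n
        rw [← Nat.cast_sub hle]
        exact_mod_cast congrArg (Nat.cast (R := ZMod p)) this
      · rw [Nat.choose_eq_zero_of_lt hlt, Nat.choose_eq_zero_of_lt (Nat.lt_succ_of_lt hlt)]
        simp
    apply mul_right_cancel₀ hne
    rw [h, pow_succ]
    linear_combination (-1) ^ n * hch

theorem hasse_coeff (n : ℕ) :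
    (hasse p).coeff n = ((((p - 1) / 2).choose n ^ 2 : ℕ) : BaseRing p) := by
  rw [hasse, Polynomial.finsetSum_coeff]
  simp only [Polynomial.coeff_C_mul, Polynomial.coeff_X_pow, mul_ite, mul_one, mul_zero]
  rw [Finset.sum_ite_eq]
  split_ifs with h
  · rfl
  · rw [Finset.mem_range, not_lt] at h
    rw [Nat.choose_eq_zero_of_lt (by omega)]
    simp

theorem trunc_sub_hasse_mem (hp : Odd p) {b : ℕ → BaseRing p} (h0 : b 0 = 1)
    (hb : ∀ n : ℕ, b (n + 1) * qNum ((n : ℤ_[p]) + 1) = b n * qNum ((n : ℤ_[p]) + half p)) :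
    ((trunc p (mk fun n => b n ^ 2) : Polynomial (BaseRing p)) : PowerSeries (BaseRing p)) -
      (hasse p : PowerSeries (BaseRing p)) ∈ serIdeal p := by
  rw [mem_serIdeal]
  intro n
  rw [map_sub, Polynomial.coeff_coe, Polynomial.coeff_coe, coeff_trunc, hasse_coeff,
    mem_baseIdeal_iff, map_sub, map_natCast]
  split_ifs with hn
  -- Squaring removes the sign.
  · rw [coeff_mk, map_pow, residue_eq_neg_one_pow_mul_choose hp h0 hb n hn, mul_pow, ← pow_mul,
      mul_comm n 2, pow_mul, neg_one_sq, one_pow, one_mul, Nat.cast_pow, sub_self]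
  · have := (Fact.out : p.Prime).pos
    rw [Nat.choose_eq_zero_of_lt (by omega)]
    simp

end Hypergeometric

end QDwork

theorem corollary6p6 (p : ℕ) [Fact p.Prime] (hp : Odd p) :
    (∀ (B : ℕ → QDwork.BaseRing p) (hB : QDwork.DworkConditions B),
      Function.Injective (QDwork.expand (PowerSeries.trunc p (PowerSeries.mk B))
        (QDwork.trunc_coeff_zero hB.zero_eq_one)) ∧
      QDwork.qDeriv (PowerSeries.mk B) * PowerSeries.invOfUnit (PowerSeries.mk B) 1 ∈
        (QDwork.expand (PowerSeries.trunc p (PowerSeries.mk B))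
          (QDwork.trunc_coeff_zero hB.zero_eq_one)).range ∧
      QDwork.qDeriv (PowerSeries.mk B) *
          PowerSeries.invOfUnit (QDwork.gam (PowerSeries.mk B)) 1 ∈
        (QDwork.expand (PowerSeries.trunc p (PowerSeries.mk B))
          (QDwork.trunc_coeff_zero hB.zero_eq_one)).range) ∧
    ∃ (B : ℕ → QDwork.BaseRing p) (h0 : B 0 = 1),
      (∀ n, algebraMap (QDwork.BaseRing p) (QDwork.QuotField p) (B n) = QDwork.hypCoeff p n) ∧
      ∃ e : QDwork.CompRing (PowerSeries.trunc p (PowerSeries.mk B))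
          ≃ₐ[Polynomial (QDwork.BaseRing p)] QDwork.CompRing (QDwork.hasse p),
        ∀ t, QDwork.expand (QDwork.hasse p) (QDwork.hasse_coeff_zero p) (e t) =
          QDwork.expand (PowerSeries.trunc p (PowerSeries.mk B))
            (QDwork.trunc_coeff_zero h0) t := by
  refine ⟨fun B hB => ?_, ?_⟩
  · obtain ⟨c, hc⟩ := hB.exists_frobContinuous
    exact ⟨QDwork.expand_injective, QDwork.qDeriv_mul_inv_mem_range hc _⟩
  · choose b hb using QDwork.exists_algebraMap_eq_prod (p := p) hp
    have hinj : Function.Injective (algebraMap (QDwork.BaseRing p) (QDwork.QuotField p)) :=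
      IsFractionRing.injective _ _
    have h0 : b 0 = 1 := hinj (by rw [hb, Finset.range_zero, Finset.prod_empty, map_one])
    have hne : ∀ n : ℕ, algebraMap (QDwork.BaseRing p) (QDwork.QuotField p)
        (QDwork.qNum ((n : ℤ_[p]) + 1)) ≠ 0 := fun n h =>
      QDwork.qNum_natCast_succ_ne_zero n (hinj (h.trans (map_zero _).symm))
    have hrec : ∀ n : ℕ, b (n + 1) * QDwork.qNum ((n : ℤ_[p]) + 1) =
        b n * QDwork.qNum ((n : ℤ_[p]) + QDwork.half p) := by
      intro n
      apply hinj
      rw [map_mul, map_mul, hb, hb, Finset.prod_range_succ, mul_assoc, div_mul_cancel₀ _ (hne n)]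
    refine ⟨fun n => b n ^ 2, by simp [h0], fun n => ?_, ?_⟩
    · rw [map_pow, hb, QDwork.hypCoeff, Finset.prod_pow]
    · exact QDwork.exists_algEquiv_of_sub_mem (QDwork.trunc_sub_hasse_mem hp h0 hrec)
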